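/- All manifolds are Hausdorff and smooth ($C^\infty$). A manifold with boundary is locally modelled on $\mathbb{R}^{n-1}\times[0,\infty)$; a closed manifold is a compact manifold without boundary. Two closed $n$-manifolds $M,N$ are cobordant if there is a compact $(n+1)$-manifold with boundary $W$ whose boundary $\partial W$ is the disjoint union $M\sqcup N$, i.e. there is a smooth embedding $M\sqcup N\to W$ with image $\partial W$. The following hold. (1) Every compact one-dimensional manifold with boundary has finitely many boundary points, and their number is even. (2) Every connected compact one-dimensional manifold with boundary is diffeomorphic to the circle $S^1$ or to the interval $[0,1]$. (3) For $m\in\mathbb{N}$, there is a compact one-dimensional manifold with boundary that has exactly $m$ boundary points if and only if $m$ is even. (4) Every closed zero-dimensional manifold $M$ is finite; $M$ is cobordant to the empty manifold if and only if its number of points is even, and $M$ is cobordant to the one-point manifold if and only if its number of points is odd. (5) Cobordism is an equivalence relation on closed zero-dimensional manifolds; two of them are cobordant if and only if their numbers of points have the same parity, and there are exactly two cobordism classes. -/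

import Mathlib

open scoped Manifold ContDiff

universe u

/-- A closed smooth `n`-manifold: a compact Hausdorff smooth manifold modelled on `ℝⁿ` (hence
without boundary). Second countability follows from compactness. -/
structure ClosedManifold (n : ℕ) : Type (u + 1) where
  carrier : Type u
  [topologicalSpace : TopologicalSpace carrier]
  [t2Space : T2Space carrier]
  [compactSpace : CompactSpace carrier]
  [chartedSpace : ChartedSpace (EuclideanSpace ℝ (Fin n)) carrier]
  [isManifold : IsManifold (𝓡 n) ∞ carrier]

namespace ClosedManifold

attribute [instance] topologicalSpace t2Space compactSpace chartedSpace isManifold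

/-- The empty manifold, in dimension `n`. -/
noncomputable def empty (n : ℕ) : ClosedManifold.{u} n :=
  letI : ChartedSpace (EuclideanSpace ℝ (Fin n)) PEmpty.{u + 1} := ChartedSpace.empty _ _
  { carrier := PEmpty.{u + 1} }

/-- The one-point manifold. -/
noncomputable def point : ClosedManifold.{u} 0 :=
  letI : ChartedSpace (EuclideanSpace ℝ (Fin 0)) PUnit.{u + 1} := ChartedSpace.ofDiscreteTopology
  { carrier := PUnit.{u + 1}
    isManifold := IsManifold.of_discreteTopology _ }

/-- Two closed `n`-manifolds `M`, `N` are cobordant if there is a compact smooth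
`(n + 1)`-manifold with boundary `W` whose boundary is the disjoint union of `M` and `N`, i.e.
there is a smooth embedding of `M ⊔ N` into `W` with image `∂W`. -/
def Cobordant {n : ℕ} (M N : ClosedManifold.{u} n) : Prop :=
  ∃ (W : Type u) (_ : TopologicalSpace W) (_ : T2Space W) (_ : CompactSpace W)
    (_ : ChartedSpace (EuclideanHalfSpace (n + 1)) W) (_ : IsManifold (𝓡∂ (n + 1)) ∞ W)
    (f : M.carrier ⊕ N.carrier → W),
    Manifold.IsSmoothEmbedding (𝓡 n) (𝓡∂ (n + 1)) ∞ f ∧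
      Set.range f = (𝓡∂ (n + 1)).boundary W

/-- The set of cobordism classes of closed `n`-manifolds. -/
def CobordismClass (n : ℕ) : Type (u + 1) :=
  Quot (Cobordant : ClosedManifold.{u} n → ClosedManifold.{u} n → Prop)

end ClosedManifold

/-! ### Arc length on a half-line -/

section

open Set Filter Topology

/-! The classification rests on arc length, with the boundary treated as a mirror. A compact `M` has
an immersion `e` into a Euclidean space, so each half-line chart can be reparametrized to have unit
speed (`exists_unitChart`). The inverse of such a chart is extended evenly to negative parameters: a
curve that reaches the boundary folds back instead of stopping. Two unit speed parametrizations with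
a common value differ near it by an isometry `t ↦ ±t + c`, and an identity principle
(`eqOn_of_isUnitSpeedAt`) globalizes such agreement.

Compactness then yields a unit speed curve `γ : ℝ → M` defined for all times. Its image is open and
closed, hence all of a connected `M`. If `γ a = γ b`, some isometry of the line taking `a` to `b`
preserves `γ` (`isUnitSpeedAt_fiber`), so `M` is the quotient of the line by the isometries
preserving `γ`. This group is discrete, and it contains a nonzero translation because `M` is
compact. Without reflections it is `Lℤ` and `M` is a circle; with a reflection it is infinite
dihedral and `M` is a fundamental domain `[0, L/2]`.

So each of the finitely many components has 0 or 2 boundary points, and disjoint unions of intervals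
realize every even number. Any injection of a finite set into the boundary of a 1-manifold is a
smooth embedding, so cobordism of 0-manifolds reduces to parity (`cobordant_iff_even`). -/

/-- The inverse of a function with a smooth nonvanishing derivative is smooth, on one-sided
domains as well. -/
theorem contDiffOn_of_hasDerivAt_inv {T w : ℝ → ℝ} {A J : Set ℝ} (hA : UniqueDiffOn ℝ A)
    (hTA : MapsTo T A J) (hw : ContDiffOn ℝ ∞ w J) (hpos : ∀ t ∈ J, 0 < w t)
    (hT : ∀ t ∈ A, HasDerivAt T (w (T t))⁻¹ t) : ContDiffOn ℝ ∞ T A := by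
  rw [contDiffOn_infty]
  intro n
  induction n with
  | zero =>
    exact contDiffOn_zero.2 fun t ht => (hT t ht).continuousAt.continuousWithinAt
  | succ n ih =>
    have : ((n + 1 : ℕ) : WithTop ℕ∞) = n + 1 := by norm_cast
    rw [this, contDiffOn_succ_iff_derivWithin hA]
    refine ⟨fun t ht => (hT t ht).differentiableAt.differentiableWithinAt, by simp, ?_⟩
    -- Bootstrapping: `T' = 1 / (w ∘ T)` is as smooth as `T` is already known to be.
    have h1 : ContDiffOn ℝ n (fun t => (w (T t))⁻¹) A := by
      refine ContDiffOn.inv ?_ fun t ht => (hpos _ (hTA ht)).ne'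
      exact (hw.of_le (by exact_mod_cast le_top)).comp ih hTA
    exact h1.congr fun t ht => (hT t ht).hasDerivWithinAt.derivWithin (hA t ht)

/-- Arc length as an odd change of variable on the line: `w` is a speed, prescribed near `u` on the
half-line. -/
theorem exists_odd_reparametrization {w : ℝ → ℝ} {u ε : ℝ} (hu : 0 ≤ u) (hε : 0 < ε)
    (hw : ContDiffOn ℝ ∞ w (Icc (u - ε) (u + ε) ∩ Ici 0))
    (hpos : ∀ t ∈ Icc (u - ε) (u + ε) ∩ Ici 0, 0 < w t) :
    ∃ S T : ℝ → ℝ, Continuous S ∧ Continuous T ∧ (∀ t, S (T t) = t) ∧ (∀ t, T (S t) = t) ∧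
      (∀ t, S (-t) = -S t) ∧ (∀ t, T (-t) = -T t) ∧ StrictMono S ∧ StrictMono T ∧
      ContDiffOn ℝ ∞ S (Ioo (u - ε) (u + ε) ∩ Ici 0) ∧
      ContDiffOn ℝ ∞ T (T ⁻¹' (Ioo (u - ε) (u + ε) ∩ Ici 0)) ∧
      ∀ t ∈ T ⁻¹' (Ioo (u - ε) (u + ε) ∩ Ici 0), HasDerivAt T (w (T t))⁻¹ t := by
  have hle : max 0 (u - ε) ≤ u + ε := max_le (by linarith) (by linarith)
  have hK : Icc (u - ε) (u + ε) ∩ Ici 0 = Icc (max 0 (u - ε)) (u + ε) := by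
    ext t
    simp only [mem_inter_iff, mem_Icc, mem_Ici, max_le_iff]
    tauto
  have hJK : Ioo (u - ε) (u + ε) ∩ Ici 0 ⊆ Icc (u - ε) (u + ε) ∩ Ici 0 :=
    inter_subset_inter_left _ Ioo_subset_Icc_self
  have hproj : ∀ t, ((projIcc _ _ hle t : Icc (max 0 (u - ε)) (u + ε)) : ℝ) ∈
      Icc (u - ε) (u + ε) ∩ Ici 0 := fun t => by rw [hK]; exact (projIcc _ _ hle t).2
  -- Clamping `|t|` to the compact interval makes `v` even, continuous and bounded below by a
  -- positive constant; hence its integral `S` is an odd bijection of the line.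
  set v : ℝ → ℝ := fun t => w (projIcc _ _ hle |t|) with hv
  have hvc : Continuous v := by
    exact hw.continuousOn.comp_continuous
      (continuous_subtype_val.comp (continuous_projIcc.comp continuous_abs)) fun t => hproj _
  have hvw : ∀ t ∈ Icc (u - ε) (u + ε) ∩ Ici 0, v t = w t := fun t ht => by
    have h0 : 0 ≤ t := ht.2
    rw [hK] at ht
    simp only [hv, abs_of_nonneg h0, projIcc_of_mem hle ht]
  obtain ⟨m, hm, hmv⟩ : ∃ m > 0, ∀ t, m ≤ v t := by
    have hne : (Icc (u - ε) (u + ε) ∩ Ici (0 : ℝ)).Nonempty :=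
      ⟨u, by constructor <;> simp <;> linarith⟩
    have hcomp : IsCompact (Icc (u - ε) (u + ε) ∩ Ici (0 : ℝ)) :=
      isCompact_Icc.inter_right isClosed_Ici
    obtain ⟨x, hx, hmin⟩ := hcomp.exists_isMinOn hne hw.continuousOn
    exact ⟨w x, hpos x hx, fun t => hmin (hproj _)⟩
  have hvpos : ∀ t, 0 < v t := fun t => hm.trans_le (hmv t)
  set S : ℝ → ℝ := fun t => ∫ τ in (0 : ℝ)..t, v τ with hS
  have hSd : ∀ t, HasDerivAt S (v t) t := fun t =>
    intervalIntegral.integral_hasDerivAt_right (hvc.intervalIntegrable _ _)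
      hvc.stronglyMeasurable.stronglyMeasurableAtFilter hvc.continuousAt
  have hSc : Continuous S := continuous_iff_continuousAt.2 fun t => (hSd t).continuousAt
  have hSm : StrictMono S := strictMono_of_deriv_pos fun t => by rw [(hSd t).deriv]; exact hvpos t
  have hSodd : ∀ t, S (-t) = -S t := fun t => by
    have h1 : ∫ τ in (0 : ℝ)..t, v (-τ) = ∫ τ in (-t)..(-0), v τ :=
      intervalIntegral.integral_comp_neg _
    have h2 : ∀ τ, v (-τ) = v τ := fun τ => by simp [hv]
    simp only [h2, neg_zero] at h1
    simp only [hS]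
    rw [h1, intervalIntegral.integral_symm]
  have hSge : ∀ t, 0 ≤ t → m * t ≤ S t := fun t ht => by
    have := intervalIntegral.integral_mono_on (μ := MeasureTheory.volume) ht
      ((continuous_const (y := m)).intervalIntegrable 0 t)
      (hvc.intervalIntegrable 0 t) (fun x _ => hmv x)
    simpa [mul_comm] using this
  have hSsurj : Function.Surjective S := by
    have htop : Tendsto S atTop atTop :=
      tendsto_atTop_mono' _ ((eventually_ge_atTop 0).mono hSge) (tendsto_id.const_mul_atTop hm)
    have hbot : Tendsto S atBot atBot := by
      have : S = fun t => -S (-t) := by ext t; rw [hSodd, neg_neg]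
      rw [this]
      exact tendsto_neg_atTop_atBot.comp (htop.comp tendsto_neg_atBot_atTop)
    exact hSc.surjective htop hbot
  let E : ℝ ≃o ℝ := hSm.orderIsoOfSurjective S hSsurj
  have hST : ∀ t, S (E.symm t) = t := fun t => E.apply_symm_apply t
  have hTS : ∀ t, E.symm (S t) = t := fun t => E.symm_apply_apply t
  have hTc : Continuous E.symm := E.symm.continuous
  have hTd : ∀ t, HasDerivAt E.symm (v (E.symm t))⁻¹ t := fun t =>
    (hSd (E.symm t)).of_local_left_inverse hTc.continuousAt (hvpos _).ne'
      (Eventually.of_forall hST)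
  have hTodd : ∀ t, E.symm (-t) = -E.symm t := fun t => by
    apply hSm.injective
    rw [hST, hSodd, hST]
  have hT0 : E.symm 0 = 0 := by have := hTodd 0; simp at this; linarith
  have hpre : E.symm ⁻¹' (Ioo (u - ε) (u + ε) ∩ Ici 0) =
      Ici 0 ∩ E.symm ⁻¹' Ioo (u - ε) (u + ε) := by
    ext t
    simp only [mem_preimage, mem_inter_iff, mem_Ici]
    have h : 0 ≤ E.symm t ↔ 0 ≤ t := by
      conv_lhs => rw [← hT0]
      exact E.symm.le_iff_le
    rw [and_comm, h]
  have hTd' : ∀ t ∈ E.symm ⁻¹' (Ioo (u - ε) (u + ε) ∩ Ici 0),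
      HasDerivAt E.symm (w (E.symm t))⁻¹ t := fun t ht => by
    rw [← hvw _ (hJK ht)]
    exact hTd t
  refine ⟨S, E.symm, hSc, hTc, hST, hTS, hSodd, hTodd, hSm, E.symm.strictMono, ?_, ?_, hTd'⟩
  · have hud : UniqueDiffOn ℝ (Ioo (u - ε) (u + ε) ∩ Ici (0 : ℝ)) := by
      rw [inter_comm]
      exact (uniqueDiffOn_Ici 0).inter isOpen_Ioo
    rw [contDiffOn_infty_iff_derivWithin hud]
    refine ⟨fun t _ => (hSd t).differentiableAt.differentiableWithinAt, (hw.mono hJK).congr ?_⟩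
    intro t ht
    rw [(hSd t).hasDerivWithinAt.derivWithin (hud t ht), hvw t (hJK ht)]
  · refine contDiffOn_of_hasDerivAt_inv ?_ (fun t ht => ht) (hw.mono hJK)
      (fun t ht => hpos t (hJK ht)) hTd'
    rw [hpre]
    exact (uniqueDiffOn_Ici 0).inter (isOpen_Ioo.preimage hTc)

/-! ### Half-line charts of unit speed -/

/-- A coordinate `r` with values in the half-line on an open subset `U` of a one-dimensional
manifold with boundary; its inverse is extended to an even function `c` on the line. -/
structure HalfChart (M : Type u) [TopologicalSpace M] [ChartedSpace (EuclideanHalfSpace 1) M] where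
  r : M → ℝ
  c : ℝ → M
  U : Set M
  D : Set ℝ
  isOpen_U : IsOpen U
  isOpen_D : IsOpen D
  r_nonneg : ∀ x ∈ U, 0 ≤ r x
  neg_mem : ∀ t ∈ D, -t ∈ D
  c_neg : ∀ t, c (-t) = c t
  c_mem : ∀ t ∈ D, c t ∈ U
  r_mem : ∀ x ∈ U, r x ∈ D
  r_c : ∀ t ∈ D, r (c t) = |t|
  c_r : ∀ x ∈ U, c (r x) = x
  contMDiffOn_r : ContMDiffOn (𝓡∂ 1) 𝓘(ℝ) ∞ r U
  contMDiffOn_c : ContMDiffOn 𝓘(ℝ) (𝓡∂ 1) ∞ c (D ∩ Ici 0)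

/-- The point of the half-line with coordinate `|t|`. -/
def halfLinePoint (t : ℝ) : EuclideanHalfSpace 1 := ⟨WithLp.toLp 2 fun _ => |t|, abs_nonneg t⟩

theorem continuous_halfLinePoint : Continuous halfLinePoint :=
  Continuous.subtype_mk ((PiLp.continuous_toLp 2 _).comp (continuous_pi fun _ => continuous_abs)) _

theorem halfLinePoint_coord (x : EuclideanHalfSpace 1) : halfLinePoint (x.1 0) = x := by
  apply EuclideanHalfSpace.ext
  ext i
  fin_cases i
  exact abs_of_nonneg x.2

variable {M : Type u} [TopologicalSpace M] [ChartedSpace (EuclideanHalfSpace 1) M]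

theorem halfLinePoint_eq_symm {t : ℝ} (ht : 0 ≤ t) :
    halfLinePoint t = (𝓡∂ 1).symm (WithLp.toLp 2 fun _ => t) := by
  apply EuclideanHalfSpace.ext
  ext i
  fin_cases i
  simp [halfLinePoint, modelWithCornersEuclideanHalfSpace_symm_apply, abs_of_nonneg ht, ht]

/-- The half-line coordinate given by the preferred chart at a point. -/
noncomputable def halfChartAt [IsManifold (𝓡∂ 1) ∞ M] (p : M) : HalfChart M where
  r x := (chartAt (EuclideanHalfSpace 1) p x).1 0
  c t := (chartAt (EuclideanHalfSpace 1) p).symm (halfLinePoint t)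
  U := (chartAt (EuclideanHalfSpace 1) p).source
  D := halfLinePoint ⁻¹' (chartAt (EuclideanHalfSpace 1) p).target
  isOpen_U := (chartAt _ p).open_source
  isOpen_D := (chartAt _ p).open_target.preimage continuous_halfLinePoint
  r_nonneg x _ := (chartAt (EuclideanHalfSpace 1) p x).2
  neg_mem t ht := by simpa [halfLinePoint] using ht
  c_neg t := by simp [halfLinePoint]
  c_mem t ht := (chartAt _ p).map_target ht
  r_mem x hx := by
    rw [mem_preimage, halfLinePoint_coord]
    exact (chartAt _ p).map_source hx
  r_c t ht := by
    rw [(chartAt _ p).right_inv ht]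
    rfl
  c_r x hx := by
    rw [halfLinePoint_coord, (chartAt _ p).left_inv hx]
  contMDiffOn_r := by
    have h := contMDiffOn_extChartAt (I := 𝓡∂ 1) (n := ∞) (x := p)
    have hc : ContMDiff (𝓡 1) 𝓘(ℝ) ∞ fun x : EuclideanSpace ℝ (Fin 1) => x 0 :=
      (EuclideanSpace.proj (𝕜 := ℝ) (0 : Fin 1)).contDiff.contMDiff
    exact hc.comp_contMDiffOn h
  contMDiffOn_c := by
    have h := contMDiffOn_extChartAt_symm (I := 𝓡∂ 1) (n := ∞) p
    have hc : ContMDiff 𝓘(ℝ) (𝓡 1) ∞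
        fun t : ℝ => (WithLp.toLp 2 fun _ => t : EuclideanSpace ℝ (Fin 1)) := by
      apply ContDiff.contMDiff
      fun_prop
    refine (h.comp hc.contMDiffOn
      (s := halfLinePoint ⁻¹' (chartAt (EuclideanHalfSpace 1) p).target ∩ Ici 0) ?_).congr ?_
    · rintro t ⟨ht, ht0⟩
      rw [mem_preimage, halfLinePoint_eq_symm ht0] at ht
      rw [mem_preimage, extChartAt_target, range_modelWithCornersEuclideanHalfSpace]
      exact ⟨ht, ht0⟩
    · rintro t ⟨ht, ht0⟩
      simp [halfLinePoint_eq_symm ht0]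

/-- A half-line coordinate whose inverse has unit speed, as measured in a normed space `F` through
the map `e`. -/
structure UnitChart {F : Type*} [NormedAddCommGroup F] [NormedSpace ℝ F] (e : M → F)
    extends HalfChart M where
  unit_speed : ∀ t ∈ D, 0 ≤ t → ∃ v, ‖v‖ = 1 ∧ HasDerivWithinAt (e ∘ c) v (Ici 0) t

theorem exists_unitChart [IsManifold (𝓡∂ 1) ∞ M] {F : Type*} [NormedAddCommGroup F]
    [InnerProductSpace ℝ F] {e : M → F} (he : ContMDiff (𝓡∂ 1) 𝓘(ℝ, F) ∞ e)
    (hinj : ∀ x, Function.Injective (mfderiv (𝓡∂ 1) 𝓘(ℝ, F) e x)) (p : M) :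
    ∃ C : UnitChart e, p ∈ C.U := by
  set H := halfChartAt p with hH
  have hpU : p ∈ H.U := mem_chart_source _ p
  set u := H.r p with hu
  have hu0 : 0 ≤ u := H.r_nonneg p hpU
  set B := H.D ∩ Ici 0 with hB
  have huB : u ∈ B := ⟨H.r_mem p hpU, hu0⟩
  have hud : UniqueDiffOn ℝ B := by
    rw [hB, inter_comm]
    exact (uniqueDiffOn_Ici 0).inter H.isOpen_D
  have hf : ContDiffOn ℝ ∞ (e ∘ H.c) B :=
    contMDiffOn_iff_contDiffOn.1 (he.comp_contMDiffOn H.contMDiffOn_c)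
  set g := derivWithin (e ∘ H.c) B with hg
  have hgs : ContDiffOn ℝ ∞ g B := ((contDiffOn_infty_iff_derivWithin hud).1 hf).2
  have hfd : ∀ t ∈ B, HasDerivWithinAt (e ∘ H.c) (g t) (Ici 0) t := fun t ht => by
    have h := ((hf.differentiableOn (by simp)) t ht).hasDerivWithinAt
    exact h.mono_of_mem_nhdsWithin
      (inter_mem (mem_nhdsWithin_of_mem_nhds (H.isOpen_D.mem_nhds ht.1)) self_mem_nhdsWithin)
  -- By the chain rule `g u` is the image of the coordinate vector `ℓ 1` under the injective
  -- differential of `e`.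
  have hgu : g u ≠ 0 := by
    have h1 := ((he p).mdifferentiableAt (by simp)).hasMFDerivAt.2
    set ℓ : ℝ → EuclideanSpace ℝ (Fin 1) := fun t => WithLp.toLp 2 fun _ => t with hℓ
    have h2 : HasDerivAt ℓ (ℓ 1) u := by
      have h3 : HasDerivAt (fun t : ℝ => t • ℓ 1) ((1 : ℝ) • ℓ 1) u :=
        (hasDerivAt_id u).smul_const _
      rw [one_smul] at h3
      refine h3.congr_of_eventuallyEq (Eventually.of_forall fun t => ?_)
      ext i
      simp [hℓ]
    have hup : ℓ u = extChartAt (𝓡∂ 1) p p := by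
      ext i
      fin_cases i
      rfl
    rw [← hup] at h1
    have h4 := h1.comp_hasDerivWithinAt (s := B) u h2.hasDerivWithinAt (fun t ht => by
      rw [range_modelWithCornersEuclideanHalfSpace]; exact ht.2)
    have h5 : g u = mfderiv (𝓡∂ 1) 𝓘(ℝ, F) e p (ℓ 1) := by
      refine HasDerivWithinAt.derivWithin (h4.congr ?_ ?_) (hud u huB)
      · intro t ht
        simp [hH, halfChartAt, halfLinePoint_eq_symm ht.2, writtenInExtChartAt, hℓ]
        rfl
      · simp [hH, halfChartAt, halfLinePoint_eq_symm hu0, writtenInExtChartAt, hℓ]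
        rfl
    rw [h5]
    intro h0
    have h6 : ℓ 1 = 0 := hinj p (h0.trans (map_zero _).symm)
    have h7 := congrArg (fun x : EuclideanSpace ℝ (Fin 1) => x 0) h6
    simp [hℓ] at h7
  obtain ⟨ε, hε, hεB⟩ : ∃ ε > 0, ∀ t ∈ Icc (u - ε) (u + ε) ∩ Ici 0, t ∈ B ∧ g t ≠ 0 := by
    have hev : ∀ᶠ t in 𝓝[Ici 0] u, t ∈ B ∧ g t ≠ 0 := by
      have hnhds : 𝓝[Ici 0] u = 𝓝[B] u := by
        rw [hB, inter_comm, nhdsWithin_inter_of_mem' ]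
        exact mem_nhdsWithin_of_mem_nhds (H.isOpen_D.mem_nhds huB.1)
      rw [hnhds]
      exact eventually_mem_nhdsWithin.and
        ((hgs.continuousOn u huB).eventually_ne hgu)
    rw [eventually_nhdsWithin_iff] at hev
    obtain ⟨ε, hε, h⟩ := Metric.nhds_basis_closedBall.mem_iff.1 hev
    refine ⟨ε, hε, fun t ht => h ?_ ht.2⟩
    rw [Real.closedBall_eq_Icc]
    exact ht.1
  set w : ℝ → ℝ := fun t => ‖g t‖ with hw
  have hws : ContDiffOn ℝ ∞ w (Icc (u - ε) (u + ε) ∩ Ici 0) :=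
    (hgs.mono fun t ht => (hεB t ht).1).norm ℝ fun t ht => (hεB t ht).2
  obtain ⟨S, T, hSc, hTc, hST, hTS, hSodd, hTodd, hSm, hTm, hSs, hTs, hTd⟩ :=
    exists_odd_reparametrization hu0 hε hws fun t ht => norm_pos_iff.2 (hεB t ht).2
  have hS0 : S 0 = 0 := by have := hSodd 0; simp at this; linarith
  have hT0 : T 0 = 0 := by have := hTodd 0; simp at this; linarith
  have hSnn : ∀ t, 0 ≤ t → 0 ≤ S t := fun t ht => hS0 ▸ hSm.monotone ht
  have hTnn : ∀ t, 0 ≤ t → 0 ≤ T t := fun t ht => hT0 ▸ hTm.monotone ht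
  have hTabs : ∀ t, |T t| = T |t| := fun t => by
    rcases le_total 0 t with h | h
    · rw [abs_of_nonneg h, abs_of_nonneg (hTnn t h)]
    · rw [abs_of_nonpos h, hTodd, abs_of_nonpos]
      have := hTnn (-t) (by linarith)
      rw [hTodd] at this
      linarith
  have hJ : ∀ t, |T t| ∈ Ioo (u - ε) (u + ε) → |T t| ∈ Icc (u - ε) (u + ε) ∩ Ici 0 :=
    fun t ht => ⟨Ioo_subset_Icc_self ht, mem_Ici.2 (abs_nonneg _)⟩
  have hDT : ∀ t, |T t| ∈ Ioo (u - ε) (u + ε) → T t ∈ H.D := fun t ht => by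
    have h1 := (hεB _ (hJ t ht)).1.1
    rcases abs_choice (T t) with h | h
    · rwa [h] at h1
    · rw [h] at h1
      simpa using H.neg_mem _ h1
  have hcont : ContinuousOn H.r H.U := H.contMDiffOn_r.continuousOn
  -- Since `T` is odd, `H.c ∘ T` is again even.
  refine ⟨{ r := S ∘ H.r, c := H.c ∘ T, U := H.U ∩ H.r ⁻¹' Ioo (u - ε) (u + ε),
            D := {t | |T t| ∈ Ioo (u - ε) (u + ε)},
            isOpen_U := ?_, isOpen_D := ?_, r_nonneg := ?_, neg_mem := ?_, c_neg := ?_, c_mem := ?_,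
            r_mem := ?_, r_c := ?_, c_r := ?_, contMDiffOn_r := ?_, contMDiffOn_c := ?_, unit_speed := ?_ },
    ⟨hpU, by simp [← hu, hε]⟩⟩
  · exact hcont.isOpen_inter_preimage H.isOpen_U isOpen_Ioo
  · exact isOpen_Ioo.preimage (continuous_abs.comp hTc)
  · exact fun x hx => hSnn _ (H.r_nonneg x hx.1)
  · intro t ht
    simpa [hTodd] using ht
  · intro t
    simp [hTodd, H.c_neg]
  · intro t ht
    refine ⟨H.c_mem _ (hDT t ht), ?_⟩
    simp only [mem_preimage, Function.comp_apply]
    rw [H.r_c _ (hDT t ht)]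
    exact ht
  · intro x hx
    simp only [Function.comp_apply, mem_ofPred_eq]
    rw [hTS, abs_of_nonneg (H.r_nonneg x hx.1)]
    exact hx.2
  · intro t ht
    simp only [Function.comp_apply]
    rw [H.r_c _ (hDT t ht), hTabs, hST]
  · intro x hx
    simp only [Function.comp_apply]
    rw [hTS, H.c_r x hx.1]
  · exact (contMDiffOn_iff_contDiffOn.2 hSs).comp (H.contMDiffOn_r.mono inter_subset_left)
      fun x hx => ⟨hx.2, H.r_nonneg x hx.1⟩
  · have hT' := contMDiffOn_iff_contDiffOn.2 hTs
    refine H.contMDiffOn_c.comp (hT'.mono ?_) ?_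
    · rintro t ⟨ht, ht0⟩
      refine ⟨?_, hTnn t ht0⟩
      simpa [abs_of_nonneg (hTnn t ht0)] using ht
    · rintro t ⟨ht, ht0⟩
      exact ⟨hDT t ht, hTnn t ht0⟩
  · intro t ht ht0
    have habs := abs_of_nonneg (hTnn t ht0)
    have hTt : T t ∈ Ioo (u - ε) (u + ε) ∩ Ici 0 := ⟨by simpa [habs] using ht, hTnn t ht0⟩
    have hgt := hεB (T t) ⟨Ioo_subset_Icc_self hTt.1, hTt.2⟩
    refine ⟨(w (T t))⁻¹ • g (T t), ?_, ?_⟩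
    · rw [norm_smul, norm_inv, hw, norm_norm, inv_mul_cancel₀ (norm_ne_zero_iff.2 hgt.2)]
    · exact (hfd (T t) hgt.1).scomp t (hTd t hTt).hasDerivWithinAt fun s hs => hTnn s hs

/-! ### Transition maps are isometries -/

namespace UnitChart

variable {F : Type*} [NormedAddCommGroup F] [NormedSpace ℝ F] {e : M → F}

/-- The transition map `C'.r ∘ C.c` goes between two parametrizations of speed one, so its
derivative is `±1`. The derivative is continuous, so the sign is locally constant and the map is
affine. Nonnegativity is recorded because it later distinguishes boundary points from interior ones.
-/
theorem exists_transition (C C' : UnitChart e) {s s' : ℝ} (hs : s ∈ C.D) (hs0 : 0 ≤ s)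
    (hs' : s' ∈ C'.D) (hs0' : 0 ≤ s') (h : C.c s = C'.c s') :
    ∃ σ : ℝ, (σ = 1 ∨ σ = -1) ∧
      ∀ᶠ t in 𝓝[Ici 0] s, C.c t = C'.c (s' + σ * (t - s)) ∧ 0 ≤ s' + σ * (t - s) := by
  have hcs : C.c s ∈ C'.U := h ▸ C'.c_mem s' hs'
  have hsB : s ∈ C.D ∩ Ici 0 := ⟨hs, hs0⟩
  have hnhds : 𝓝[C.D ∩ Ici 0] s = 𝓝[Ici 0] s := by
    rw [inter_comm, nhdsWithin_inter_of_mem']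
    exact mem_nhdsWithin_of_mem_nhds (C.isOpen_D.mem_nhds hs)
  have hev : ∀ᶠ t in 𝓝[Ici 0] s, t ∈ C.D ∩ Ici 0 ∧ C.c t ∈ C'.U := by
    rw [← hnhds]
    exact eventually_mem_nhdsWithin.and
      ((C.contMDiffOn_c.continuousOn s hsB).eventually (C'.isOpen_U.mem_nhds hcs))
  rw [eventually_nhdsWithin_iff] at hev
  obtain ⟨ε, hε, hball⟩ := Metric.nhds_basis_ball.mem_iff.1 hev
  rw [Real.ball_eq_Ioo] at hball
  set K := Ioo (s - ε) (s + ε) ∩ Ici 0 with hK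
  have hKB : ∀ t ∈ K, t ∈ C.D ∩ Ici 0 ∧ C.c t ∈ C'.U := fun t ht => hball ht.1 ht.2
  have hsK : s ∈ K := ⟨by simp [hε], hs0⟩
  have hud : UniqueDiffOn ℝ K := by
    rw [hK, inter_comm]
    exact (uniqueDiffOn_Ici 0).inter isOpen_Ioo
  have hnK : 𝓝[K] s = 𝓝[Ici 0] s := by
    rw [hK, inter_comm, nhdsWithin_inter_of_mem']
    exact mem_nhdsWithin_of_mem_nhds (isOpen_Ioo.mem_nhds hsK.1)
  set φ : ℝ → ℝ := C'.r ∘ C.c with hφ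
  have hφs : ContDiffOn ℝ ∞ φ K := contMDiffOn_iff_contDiffOn.1
    (C'.contMDiffOn_r.comp (C.contMDiffOn_c.mono fun t ht => (hKB t ht).1) fun t ht => (hKB t ht).2)
  have hφ0 : ∀ t ∈ K, 0 ≤ φ t := fun t ht => C'.r_nonneg _ (hKB t ht).2
  have hcφ : ∀ t ∈ K, C'.c (φ t) = C.c t := fun t ht => C'.c_r _ (hKB t ht).2
  have hφss : φ s = s' := by
    simp only [hφ, Function.comp_apply, h]
    rw [C'.r_c s' hs', abs_of_nonneg hs0']
  set d := derivWithin φ K with hd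
  have hdc : ContinuousOn d K := ((contDiffOn_infty_iff_derivWithin hud).1 hφs).2.continuousOn
  have hφd : ∀ t ∈ K, HasDerivWithinAt φ (d t) K t := fun t ht =>
    ((hφs.differentiableOn (by simp)) t ht).hasDerivWithinAt
  have habs : ∀ t ∈ K, |d t| = 1 := fun t ht => by
    obtain ⟨v, hv, hvd⟩ := C.unit_speed t (hKB t ht).1.1 ht.2
    obtain ⟨v', hv', hvd'⟩ := C'.unit_speed (φ t) (C'.r_mem _ (hKB t ht).2) (hφ0 t ht)
    have h1 := hvd'.scomp t (hφd t ht) fun t ht => hφ0 t ht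
    have h2 : HasDerivWithinAt (e ∘ C.c) (d t • v') K t :=
      h1.congr (fun x hx => by simp [hcφ x hx]) (by simp [hcφ t ht])
    have h3 := (hud t ht).eq_deriv _ (hvd.mono inter_subset_right) h2
    rw [h3, norm_smul, hv', mul_one] at hv
    exact hv
  have hval : ∀ t ∈ K, d t = 1 ∨ d t = -1 := fun t ht => eq_or_eq_neg_of_abs_eq (habs t ht)
  have hev2 : ∀ᶠ t in 𝓝[Ici 0] s, t ∈ K ∧ d t = d s := by
    rw [← hnK]
    -- The values `1` and `-1` are at distance 2, so closeness forces equality.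
    have h1 : ∀ᶠ t in 𝓝[K] s, dist (d t) (d s) < 1 :=
      (hdc s hsK).eventually (Metric.ball_mem_nhds _ one_pos)
    filter_upwards [h1, self_mem_nhdsWithin] with t ht htK
    refine ⟨htK, ?_⟩
    rw [Real.dist_eq, abs_lt] at ht
    rcases hval t htK with h | h <;> rcases hval s hsK with h' | h' <;> rw [h, h'] at ht <;>
      linarith [ht.1, ht.2]
  refine ⟨d s, hval s hsK, ?_⟩
  rw [eventually_nhdsWithin_iff] at hev2
  obtain ⟨η, hη, hball2⟩ := Metric.nhds_basis_ball.mem_iff.1 hev2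
  rw [eventually_nhdsWithin_iff]
  filter_upwards [Metric.ball_mem_nhds s hη] with t ht ht0
  set K' := Metric.ball s η ∩ Ici 0 with hK'
  have hK'K : K' ⊆ K := fun x hx => (hball2 hx.1 hx.2).1
  have hder : ∀ x ∈ K', HasDerivWithinAt (fun x => φ x - d s * x) (d x - d s * 1) K' x := fun x hx =>
    ((hφd x (hK'K hx)).mono hK'K).sub ((hasDerivWithinAt_id x K').const_mul (d s))
  have hconv : Convex ℝ K' := (convex_ball s η).inter (convex_Ici 0)
  have hb := hconv.norm_image_sub_le_of_norm_hasDerivWithin_le (C := 0) hder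
    (fun x hx => by rw [(hball2 hx.1 hx.2).2]; simp) (x := s) (y := t)
    ⟨Metric.mem_ball_self hη, hs0⟩ ⟨ht, ht0⟩
  have heq : φ t = s' + d s * (t - s) := by
    rw [zero_mul, norm_le_zero_iff, hφss] at hb
    linarith
  have htK : t ∈ K := hK'K ⟨ht, ht0⟩
  rw [← heq]
  exact ⟨(hcφ t htK).symm, hφ0 t htK⟩

theorem eventuallyEq_of_nonneg (C C' : UnitChart e) {s s' : ℝ} (hs : s ∈ C.D) (hs0 : 0 ≤ s)
    (hs' : s' ∈ C'.D) (hs0' : 0 ≤ s') (h : C.c s = C'.c s') :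
    ∃ σ : ℝ, (σ = 1 ∨ σ = -1) ∧ ∀ᶠ t in 𝓝 (0 : ℝ), C.c (s + t) = C'.c (s' + σ * t) := by
  -- Invariance of the boundary: an interior parameter can move both ways by `η`, and the affine
  -- transition stays nonnegative at both ends, so `b ≥ η`.
  have key : ∀ (A B : UnitChart e) {a b : ℝ}, a ∈ A.D → 0 < a → b ∈ B.D → 0 ≤ b →
      A.c a = B.c b → 0 < b := by
    intro A B a b ha ha0 hb hb0 hab
    obtain ⟨σ, hσ, hev⟩ := A.exists_transition B ha ha0.le hb hb0 hab
    rw [nhdsWithin_eq_nhds.2 (Ici_mem_nhds ha0)] at hev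
    obtain ⟨η, hη, hball⟩ := Metric.nhds_basis_closedBall.mem_iff.1 hev
    have h1 := (hball (a := a + η) (by simp [abs_of_pos hη])).2
    have h2 := (hball (a := a - η) (by simp [abs_of_pos hη])).2
    rcases hσ with rfl | rfl <;> nlinarith
  obtain ⟨σ, hσ, hev⟩ := C.exists_transition C' hs hs0 hs' hs0' h
  refine ⟨σ, hσ, ?_⟩
  rcases hs0.lt_or_eq with hpos | rfl
  · rw [nhdsWithin_eq_nhds.2 (Ici_mem_nhds hpos)] at hev
    have ht : Tendsto (fun t : ℝ => s + t) (𝓝 0) (𝓝 s) := by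
      have : Continuous fun t : ℝ => s + t := by fun_prop
      simpa using this.tendsto 0
    filter_upwards [ht.eventually hev] with t ht
    rw [ht.1]
    congr 1
    ring
  · rcases hs0'.lt_or_eq with hpos' | rfl
    · exact absurd (key C' C hs' hpos' hs le_rfl h.symm) (lt_irrefl _)
    -- At a common boundary point the identity holds for `t ≥ 0` only; evenness of both
    -- parametrizations supplies `t ≤ 0`.
    · rw [eventually_nhdsWithin_iff] at hev
      have ht : Tendsto (fun t : ℝ => |t|) (𝓝 0) (𝓝 0) := by
        simpa using continuous_abs.tendsto (0 : ℝ)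
      filter_upwards [ht.eventually hev] with t ht
      have h1 := (ht (abs_nonneg t)).1
      simp only [sub_zero, zero_add] at h1 ⊢
      rcases le_total 0 t with h0 | h0
      · rwa [abs_of_nonneg h0] at h1
      · rwa [abs_of_nonpos h0, C.c_neg, mul_neg, C'.c_neg] at h1

theorem _root_.HalfChart.c_add_eq (C : HalfChart M) (s : ℝ) :
    ∃ σ : ℝ, (σ = 1 ∨ σ = -1) ∧ ∀ t, C.c (s + t) = C.c (|s| + σ * t) := by
  rcases le_total 0 s with h | h
  · exact ⟨1, .inl rfl, fun t => by rw [abs_of_nonneg h, one_mul]⟩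
  · refine ⟨-1, .inr rfl, fun t => ?_⟩
    rw [abs_of_nonpos h, ← C.c_neg]
    congr 1
    ring

/-- Two unit speed parametrizations agree near a common value, up to an isometry of the line. -/
theorem exists_eventuallyEq (C C' : UnitChart e) {s s' : ℝ} (hs : s ∈ C.D) (hs' : s' ∈ C'.D)
    (h : C.c s = C'.c s') :
    ∃ σ : ℝ, (σ = 1 ∨ σ = -1) ∧ ∀ᶠ t in 𝓝 (0 : ℝ), C.c (s + t) = C'.c (s' + σ * t) := by
  have habs : ∀ (A : UnitChart e) {a : ℝ}, a ∈ A.D → |a| ∈ A.D ∧ A.c |a| = A.c a := fun A a ha => by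
    rcases abs_choice a with h | h <;> rw [h]
    · exact ⟨ha, rfl⟩
    · exact ⟨A.neg_mem a ha, A.c_neg a⟩
  obtain ⟨σ₁, hσ₁, h₁⟩ := C.c_add_eq s
  obtain ⟨σ₂, hσ₂, h₂⟩ := C'.c_add_eq s'
  obtain ⟨σ, hσ, hev⟩ := C.eventuallyEq_of_nonneg C' (habs C hs).1 (abs_nonneg s) (habs C' hs').1
    (abs_nonneg s') (by rw [(habs C hs).2, (habs C' hs').2, h])
  have ht : Tendsto (fun t : ℝ => σ₁ * t) (𝓝 0) (𝓝 0) := by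
    have : Continuous fun t : ℝ => σ₁ * t := by fun_prop
    simpa using this.tendsto 0
  refine ⟨σ₂ * σ * σ₁, ?_, ?_⟩
  · rcases hσ₁ with rfl | rfl <;> rcases hσ₂ with rfl | rfl <;> rcases hσ with rfl | rfl <;> norm_num
  · filter_upwards [ht.eventually hev] with t ht
    rw [h₁, h₂, ht]
    have : σ₂ * σ₂ = 1 := by rcases hσ₂ with rfl | rfl <;> norm_num
    congr 1
    linear_combination -(σ * σ₁ * t) * this

end UnitChart

namespace HalfChart

theorem c_abs (C : HalfChart M) (t : ℝ) : C.c |t| = C.c t := by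
  rcases abs_choice t with h | h <;> rw [h]
  exact C.c_neg t

theorem abs_mem (C : HalfChart M) {t : ℝ} (ht : t ∈ C.D) : |t| ∈ C.D := by
  rcases abs_choice t with h | h <;> rw [h]
  exacts [ht, C.neg_mem t ht]

theorem continuousAt_c (C : HalfChart M) {t : ℝ} (ht : t ∈ C.D) : ContinuousAt C.c t := by
  have h : ContinuousOn (C.c ∘ fun t => |t|) C.D :=
    C.contMDiffOn_c.continuousOn.comp continuous_abs.continuousOn
      fun s hs => ⟨C.abs_mem hs, abs_nonneg s⟩
  have h2 : C.c ∘ (fun t => |t|) = C.c := funext fun s => C.c_abs s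
  rw [h2] at h
  exact h.continuousAt (C.isOpen_D.mem_nhds ht)

theorem continuousAt_r (C : HalfChart M) {x : M} (hx : x ∈ C.U) : ContinuousAt C.r x :=
  C.contMDiffOn_r.continuousOn.continuousAt (C.isOpen_U.mem_nhds hx)

/-- Openness survives the fold: `x ↦ σ * C.r x`, with `σ` the sign of `t`, is a continuous local
section of `c`. -/
theorem image_c_mem_nhds (C : HalfChart M) {t : ℝ} (ht : t ∈ C.D) {V : Set ℝ} (hV : V ∈ 𝓝 t) :
    C.c '' V ∈ 𝓝 (C.c t) := by
  have hU := C.c_mem t ht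
  obtain ⟨σ, hσ, hσt⟩ : ∃ σ : ℝ, (σ = 1 ∨ σ = -1) ∧ σ * |t| = t := by
    rcases abs_choice t with h | h
    · exact ⟨1, .inl rfl, by rw [h, one_mul]⟩
    · exact ⟨-1, .inr rfl, by rw [h]; ring⟩
  have hcont : ContinuousAt (fun x => σ * C.r x) (C.c t) := (C.continuousAt_r hU).const_mul σ
  have hval : σ * C.r (C.c t) = t := by rw [C.r_c t ht, hσt]
  have hev := hcont.eventually (p := fun y => y ∈ V) (by beta_reduce; rw [hval]; exact hV)
  filter_upwards [hev, C.isOpen_U.mem_nhds hU] with x hx hxU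
  refine ⟨_, hx, ?_⟩
  rcases hσ with rfl | rfl
  · rw [one_mul, C.c_r x hxU]
  · rw [neg_one_mul, C.c_neg, C.c_r x hxU]

theorem abs_eq_of_c_eq (C : HalfChart M) {s t : ℝ} (hs : s ∈ C.D) (ht : t ∈ C.D)
    (h : C.c s = C.c t) : |s| = |t| := by
  rw [← C.r_c s hs, ← C.r_c t ht, h]

end HalfChart

/-! ### Unit speed curves and the identity principle -/

section UnitSpeed

variable {F : Type*} [NormedAddCommGroup F] [NormedSpace ℝ F] {e : M → F}

/-- Near `a`, the curve `γ` is a unit speed parametrization, folded at the boundary points. -/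
def IsUnitSpeedAt (e : M → F) (γ : ℝ → M) (a : ℝ) : Prop :=
  ∃ (C : UnitChart e) (b : ℝ), a + b ∈ C.D ∧ ∀ᶠ t in 𝓝 a, γ t = C.c (t + b)

namespace IsUnitSpeedAt

variable {γ δ : ℝ → M} {a b : ℝ}

theorem congr (h : IsUnitSpeedAt e γ a) (hγ : δ =ᶠ[𝓝 a] γ) : IsUnitSpeedAt e δ a := by
  obtain ⟨C, b, hb, hev⟩ := h
  exact ⟨C, b, hb, by filter_upwards [hγ, hev] with t h1 h2 using h1.trans h2⟩

theorem comp_isometry {σ c : ℝ} (hσ : σ = 1 ∨ σ = -1) (h : IsUnitSpeedAt e γ (σ * a + c)) :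
    IsUnitSpeedAt e (fun t => γ (σ * t + c)) a := by
  obtain ⟨C, b, hb, hev⟩ := h
  have ht : Tendsto (fun t => σ * t + c) (𝓝 a) (𝓝 (σ * a + c)) :=
    Continuous.tendsto (by fun_prop) a
  rcases hσ with rfl | rfl
  · refine ⟨C, c + b, by convert hb using 1; ring, ?_⟩
    filter_upwards [ht.eventually hev] with t ht
    rw [ht]
    congr 1
    ring
  · refine ⟨C, -(c + b), by convert C.neg_mem _ hb using 1; ring, ?_⟩
    filter_upwards [ht.eventually hev] with t ht
    rw [ht, ← C.c_neg]
    congr 1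
    ring

theorem continuousAt (h : IsUnitSpeedAt e γ a) : ContinuousAt γ a := by
  obtain ⟨C, b, hb, hev⟩ := h
  have h1 : ContinuousAt (fun t => C.c (t + b)) a :=
    ContinuousAt.comp (f := fun t : ℝ => t + b) (C.continuousAt_c hb)
      (Continuous.continuousAt (by fun_prop))
  exact h1.congr (by filter_upwards [hev] with t ht using ht.symm)

theorem image_mem_nhds (h : IsUnitSpeedAt e γ a) {V : Set ℝ} (hV : V ∈ 𝓝 a) :
    γ '' V ∈ 𝓝 (γ a) := by
  obtain ⟨C, b, hb, hev⟩ := h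
  have hW : V ∩ {t | γ t = C.c (t + b)} ∈ 𝓝 a := inter_mem hV hev
  have hcont : ContinuousAt (fun y : ℝ => y - b) (a + b) := Continuous.continuousAt (by fun_prop)
  have hpre := hcont.preimage_mem_nhds (t := V ∩ {t | γ t = C.c (t + b)})
    (by rw [add_sub_cancel_right]; exact hW)
  have himg := C.image_c_mem_nhds hb hpre
  rw [← hev.self_of_nhds] at himg
  refine mem_of_superset himg ?_
  rintro _ ⟨y, ⟨hyV, hy⟩, rfl⟩
  refine ⟨y - b, hyV, ?_⟩
  have hy' : γ (y - b) = C.c (y - b + b) := hy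
  rw [hy', sub_add_cancel]

/-- A unit speed curve is locally injective, or symmetric about the point. -/
theorem injOn_or_even (h : IsUnitSpeedAt e γ a) :
    (∃ V ∈ 𝓝 a, InjOn γ V) ∨ ∀ᶠ t in 𝓝 (0 : ℝ), γ (a + t) = γ (a - t) := by
  obtain ⟨C, b, hb, hev⟩ := h
  by_cases hab : a + b = 0
  · right
    have h1 : Tendsto (fun t : ℝ => a + t) (𝓝 0) (𝓝 a) := by
      have : Continuous fun t : ℝ => a + t := by fun_prop
      simpa using this.tendsto 0
    have h2 : Tendsto (fun t : ℝ => a - t) (𝓝 0) (𝓝 a) := by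
      have : Continuous fun t : ℝ => a - t := by fun_prop
      simpa using this.tendsto 0
    filter_upwards [h1.eventually hev, h2.eventually hev] with t ht1 ht2
    rw [ht1, ht2, ← C.c_neg]
    congr 1
    linarith
  · left
    have hc : ContinuousAt (fun t : ℝ => t + b) a := Continuous.continuousAt (by fun_prop)
    have hD : ∀ᶠ t in 𝓝 a, t + b ∈ C.D := hc.eventually (C.isOpen_D.mem_nhds hb)
    have hS : ∀ᶠ t in 𝓝 a, 0 < (t + b) * (a + b) := by
      have hc2 : ContinuousAt (fun t : ℝ => (t + b) * (a + b)) a := Continuous.continuousAt (by fun_prop)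
      -- Positivity of the product keeps `t + b` on the side of `a + b`, where the absolute value is
      -- injective.
      exact hc2.eventually (lt_mem_nhds (mul_self_pos.2 hab))
    refine ⟨_, hev.and (hD.and hS), ?_⟩
    rintro s ⟨hs1, hs2, hs3⟩ t ⟨ht1, ht2, ht3⟩ hst
    rw [hs1, ht1] at hst
    rcases abs_eq_abs.1 (C.abs_eq_of_c_eq hs2 ht2 hst) with h | h
    · linarith
    · rw [h] at hs3
      linarith

/-- A fold destroys injectivity on neighbourhoods but not on one side. This is what later keeps the
periods away from zero. -/
theorem exists_injOn_Ico (h : IsUnitSpeedAt e γ a) : ∃ ε > 0, InjOn γ (Ico a (a + ε)) := by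
  obtain ⟨C, b, hb, hev⟩ := h
  have hc : ContinuousAt (fun t : ℝ => t + b) a := Continuous.continuousAt (by fun_prop)
  have hD : ∀ᶠ t in 𝓝 a, t + b ∈ C.D := hc.eventually (C.isOpen_D.mem_nhds hb)
  have hS : ∀ᶠ t in 𝓝 a, a + b < 0 → t + b < 0 := by
    by_cases h : a + b < 0
    · filter_upwards [hc.eventually (gt_mem_nhds h)] with t ht _ using ht
    · exact Eventually.of_forall fun t h' => absurd h' h
  obtain ⟨ε, hε, hball⟩ := Metric.nhds_basis_ball.mem_iff.1 (hev.and (hD.and hS))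
  rw [Real.ball_eq_Ioo] at hball
  refine ⟨ε, hε, fun s hs t ht hst => ?_⟩
  obtain ⟨hs1, hs2, hs3⟩ := hball (a := s) ⟨by linarith [hs.1], hs.2⟩
  obtain ⟨ht1, ht2, ht3⟩ := hball (a := t) ⟨by linarith [ht.1], ht.2⟩
  rw [hs1, ht1] at hst
  have habs := C.abs_eq_of_c_eq hs2 ht2 hst
  by_cases hneg : a + b < 0
  · rw [abs_of_neg (hs3 hneg), abs_of_neg (ht3 hneg)] at habs
    linarith
  · rw [abs_of_nonneg (by linarith [hs.1]), abs_of_nonneg (by linarith [ht.1])] at habs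
    linarith

theorem exists_eventuallyEq (h : IsUnitSpeedAt e γ a) (h' : IsUnitSpeedAt e δ b)
    (hab : γ a = δ b) :
    ∃ σ : ℝ, (σ = 1 ∨ σ = -1) ∧ ∀ᶠ t in 𝓝 (0 : ℝ), γ (a + t) = δ (b + σ * t) := by
  obtain ⟨C, c, hc, hev⟩ := h
  obtain ⟨C', c', hc', hev'⟩ := h'
  obtain ⟨σ, hσ, hσev⟩ := C.exists_eventuallyEq C' hc hc'
    (by rw [← hev.self_of_nhds, ← hev'.self_of_nhds, hab])
  refine ⟨σ, hσ, ?_⟩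
  have h1 : Tendsto (fun t : ℝ => a + t) (𝓝 0) (𝓝 a) := by
    have : Continuous fun t : ℝ => a + t := by fun_prop
    simpa using this.tendsto 0
  have h2 : Tendsto (fun t : ℝ => b + σ * t) (𝓝 0) (𝓝 b) := by
    have : Continuous fun t : ℝ => b + σ * t := by fun_prop
    simpa using this.tendsto 0
  filter_upwards [hσev, h1.eventually hev, h2.eventually hev'] with t h3 h4 h5
  rw [h4, h5, add_right_comm, h3]
  congr 1
  ring

end IsUnitSpeedAt

/-- Identity principle: two unit speed curves that agree near a point agree. -/
theorem eqOn_of_isUnitSpeedAt [T2Space M] {γ δ : ℝ → M} {U : Set ℝ} (hU : IsPreconnected U)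
    (hγ : ∀ t ∈ U, IsUnitSpeedAt e γ t) (hδ : ∀ t ∈ U, IsUnitSpeedAt e δ t) {a : ℝ}
    (ha : a ∈ U) (h : γ =ᶠ[𝓝 a] δ) : EqOn γ δ U := by
  have hsub : U ⊆ {t | γ =ᶠ[𝓝 t] δ} := by
    refine hU.subset_of_closure_inter_subset isOpen_setOfPred_eventually_nhds ⟨a, ha, h⟩ ?_
    rintro t ⟨htc, htU⟩
    rw [mem_closure_iff_frequently] at htc
    have hγc := (hγ t htU).continuousAt
    have hδc := (hδ t htU).continuousAt
    have heq : γ t = δ t := by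
      by_contra hne
      have hev : ∀ᶠ s in 𝓝 t, γ s ≠ δ s := (hγc.ne_iff_eventually_ne hδc).1 hne
      exact htc (hev.mono fun s hs h' => hs h'.self_of_nhds)
    obtain ⟨σ, hσ, hev⟩ := (hγ t htU).exists_eventuallyEq (hδ t htU) heq
    have htr : Tendsto (fun s : ℝ => s - t) (𝓝 t) (𝓝 0) := by
      have : Continuous fun s : ℝ => s - t := by fun_prop
      simpa using this.tendsto t
    have hev' := htr.eventually hev
    rcases hσ with rfl | rfl
    · filter_upwards [hev'] with s hs
      simpa using hs
    -- Here the germs at `t` agree up to reversal. If `δ` is locally injective, a nearby point where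
    -- the germs agree must be `t` itself; if `δ` folds at `t`, reversal does not change it.
    · rcases (hδ t htU).injOn_or_even with ⟨V, hV, hinj⟩ | heven
      · have htr2 : Tendsto (fun s : ℝ => t - (s - t)) (𝓝 t) (𝓝 t) := by
          have : Continuous fun s : ℝ => t - (s - t) := by fun_prop
          simpa using this.tendsto t
        obtain ⟨s, hs, hs1, hs2, hs3⟩ :=
          (htc.and_eventually (hev'.and ((htr2.eventually hV).and hV))).exists
        have h1 : δ s = δ (t - (s - t)) := by
          have h2 : γ s = δ s := EventuallyEq.eq_of_nhds hs
          rw [← h2]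
          convert hs1 using 2 <;> ring
        have h3 : s = t := by
          have := hinj hs3 hs2 h1
          linarith
        rw [← h3]
        exact hs
      · filter_upwards [hev', htr.eventually heven] with s h1 h2
        have h3 : t + (s - t) = s := by ring
        rw [h3] at h1 h2
        rw [h1, h2]
        congr 1
        ring
  exact fun t ht => EventuallyEq.eq_of_nhds (hsub ht)

end UnitSpeed

/-! ### Extension to all times, surjectivity and fibres -/

section UnitSpeed

variable {F : Type*} [NormedAddCommGroup F] [NormedSpace ℝ F] {e : M → F}

/-- A Lebesgue number argument: chart `p` tolerates parameters within `2 * ρ p`, the points within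
`ρ p` cover, and a finite subcover has a least `ρ`, which is the time guaranteed from every starting
point. -/
theorem exists_isUnitSpeedAt_uniform [CompactSpace M] (hC : ∀ p, ∃ C : UnitChart e, p ∈ C.U) :
    ∃ ε > 0, ∀ (q : M) (a : ℝ), ∃ γ : ℝ → M, γ a = q ∧
      ∀ t, |t - a| < ε → IsUnitSpeedAt e γ t := by
  classical
  choose C hCp using hC
  have hrad : ∀ p, ∃ ρ > 0, ∀ t, |t - (C p).r p| < 2 * ρ → t ∈ (C p).D := fun p => by
    obtain ⟨ρ, hρ, hball⟩ := Metric.isOpen_iff.1 (C p).isOpen_D _ ((C p).r_mem p (hCp p))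
    exact ⟨ρ / 2, by positivity, fun t ht => hball (by rw [Metric.mem_ball, Real.dist_eq]; linarith)⟩
  choose ρ hρ hρD using hrad
  have hnhds : ∀ p, {q | q ∈ (C p).U ∧ |(C p).r q - (C p).r p| < ρ p} ∈ 𝓝 p := fun p => by
    have h1 : ∀ᶠ q in 𝓝 p, |(C p).r q - (C p).r p| < ρ p :=
      ((C p).continuousAt_r (hCp p)).eventually (Metric.ball_mem_nhds _ (hρ p))
    exact inter_mem ((C p).isOpen_U.mem_nhds (hCp p)) h1
  obtain ⟨s, hs⟩ := CompactSpace.elim_nhds_subcover _ hnhds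
  obtain ⟨ε, hε, hερ⟩ : ∃ ε > 0, ∀ p ∈ s, ε ≤ ρ p := by
    clear hs
    induction s using Finset.induction with
    | empty => exact ⟨1, one_pos, by simp⟩
    | insert p s _ ih =>
      obtain ⟨ε, hε, h⟩ := ih
      refine ⟨min ε (ρ p), lt_min hε (hρ p), fun q hq => ?_⟩
      rcases Finset.mem_insert.1 hq with rfl | hq
      · exact min_le_right _ _
      · exact (min_le_left _ _).trans (h q hq)
  refine ⟨ε, hε, fun q a => ?_⟩
  have hq : q ∈ (⊤ : Set M) := trivial
  rw [← hs, mem_iUnion₂] at hq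
  obtain ⟨p, hp, hqU, hqr⟩ := hq
  refine ⟨fun t => (C p).c (t + ((C p).r q - a)), ?_, fun t ht => ?_⟩
  · simp only [add_sub_cancel]
    exact (C p).c_r q hqU
  · refine ⟨C p, (C p).r q - a, hρD p _ ?_, Eventually.of_forall fun t => rfl⟩
    calc |t + ((C p).r q - a) - (C p).r p| = |(t - a) + ((C p).r q - (C p).r p)| := by ring_nf
      _ ≤ |t - a| + |(C p).r q - (C p).r p| := abs_add_le _ _
      _ < 2 * ρ p := by linarith [hερ p hp]

/-- A local curve started at `γ s` agrees with `γ` near `s` after an isometry of its parameter, so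
the two can be glued at `s`. -/
theorem exists_extension_right {ε : ℝ}
    (hC : ∀ (q : M) (a : ℝ), ∃ γ : ℝ → M, γ a = q ∧ ∀ t, |t - a| < ε → IsUnitSpeedAt e γ t)
    {γ : ℝ → M} {α s : ℝ} (hs : IsUnitSpeedAt e γ s)
    (hγ : ∀ t ∈ Ioo α s, IsUnitSpeedAt e γ t) :
    ∃ γ' : ℝ → M, (∀ t ≤ s, γ' t = γ t) ∧ ∀ t ∈ Ioo α (s + ε), IsUnitSpeedAt e γ' t := by
  classical
  obtain ⟨δ₀, hδ₀s, hδ₀⟩ := hC (γ s) s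
  obtain ⟨δ, hδs, hδ⟩ : ∃ δ : ℝ → M, (∀ᶠ t in 𝓝 s, γ t = δ t) ∧
      ∀ t, |t - s| < ε → IsUnitSpeedAt e δ t := by
    by_cases hε : 0 < ε
    · obtain ⟨σ, hσ, hev⟩ := hs.exists_eventuallyEq (hδ₀ s (by simpa using hε)) hδ₀s.symm
      refine ⟨fun t => δ₀ (σ * t + (s - σ * s)), ?_, fun t ht => ?_⟩
      · have htr : Tendsto (fun t : ℝ => t - s) (𝓝 s) (𝓝 0) := by
          have : Continuous fun t : ℝ => t - s := by fun_prop
          simpa using this.tendsto s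
        filter_upwards [htr.eventually hev] with t ht
        convert ht using 2 <;> ring
      · refine IsUnitSpeedAt.comp_isometry hσ (hδ₀ _ ?_)
        have : σ * t + (s - σ * s) - s = σ * (t - s) := by ring
        rw [this, abs_mul]
        rcases hσ with rfl | rfl <;> simpa using ht
    · exact ⟨γ, Eventually.of_forall fun _ => rfl, fun t ht =>
        absurd ((abs_nonneg _).trans_lt ht) hε⟩
  refine ⟨fun t => if t ≤ s then γ t else δ t, fun t ht => if_pos ht, fun t ht => ?_⟩
  rcases lt_trichotomy t s with h | rfl | h
  · refine (hγ t ⟨ht.1, h⟩).congr ?_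
    filter_upwards [gt_mem_nhds h] with x hx
    exact if_pos (le_of_lt hx)
  · refine hs.congr ?_
    filter_upwards [hδs] with x hx
    rw [hx, ite_self]
  · refine (hδ t ?_).congr ?_
    · rw [abs_of_pos (by linarith)]
      linarith [ht.2]
    · filter_upwards [lt_mem_nhds h] with x hx
      exact if_neg (not_le.2 hx)

/-- Gluing takes place at `±(s + ε / 2)`, strictly inside the old domain, so each step gains `ε / 2`
at both ends. The left end is treated by reversing time. -/
theorem exists_extension {ε : ℝ} (hε : 0 < ε)
    (hC : ∀ (q : M) (a : ℝ), ∃ γ : ℝ → M, γ a = q ∧ ∀ t, |t - a| < ε → IsUnitSpeedAt e γ t)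
    {γ : ℝ → M} {s : ℝ} (hs : 0 ≤ s) (hγ : ∀ t, |t| < s + ε → IsUnitSpeedAt e γ t) :
    ∃ γ' : ℝ → M, (∀ t, |t| ≤ s + ε / 2 → γ' t = γ t) ∧
      ∀ t, |t| < s + ε / 2 + ε → IsUnitSpeedAt e γ' t := by
  obtain ⟨γ₁, h₁eq, h₁⟩ := exists_extension_right hC (γ := γ) (α := -(s + ε)) (s := s + ε / 2)
    (hγ _ (by rw [abs_of_nonneg (by linarith)]; linarith))
    (fun t ht => hγ t (abs_lt.2 ⟨ht.1, by linarith [ht.2]⟩))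
  have hneg : ∀ {δ : ℝ → M} {t : ℝ}, IsUnitSpeedAt e δ (-t) → IsUnitSpeedAt e (fun t => δ (-t)) t := by
    intro δ t h
    have := IsUnitSpeedAt.comp_isometry (σ := -1) (c := 0) (a := t) (γ := δ) (.inr rfl)
      (by simpa using h)
    simpa using this
  obtain ⟨γ₂, h₂eq, h₂⟩ := exists_extension_right hC (γ := fun t => γ₁ (-t))
    (α := -(s + ε / 2 + ε)) (s := s + ε / 2)
    (hneg (h₁ _ ⟨by linarith, by linarith⟩))
    (fun t ht => hneg (h₁ _ ⟨by linarith [ht.2], by linarith [ht.1]⟩))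
  refine ⟨fun t => γ₂ (-t), fun t ht => ?_, fun t ht => ?_⟩
  · rw [abs_le] at ht
    beta_reduce
    rw [h₂eq (-t) (by linarith), neg_neg, h₁eq t ht.2]
  · rw [abs_lt] at ht
    exact hneg (h₂ _ ⟨by linarith, by linarith⟩)

/-- On a compact manifold unit speed curves are defined for all times. -/
theorem exists_forall_isUnitSpeedAt [CompactSpace M] [Nonempty M]
    (hC : ∀ p, ∃ C : UnitChart e, p ∈ C.U) :
    ∃ γ : ℝ → M, ∀ t, IsUnitSpeedAt e γ t := by
  obtain ⟨ε, hε, hu⟩ := exists_isUnitSpeedAt_uniform hC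
  let P : ℕ → (ℝ → M) → Prop := fun n γ => ∀ t, |t| < n * (ε / 2) + ε → IsUnitSpeedAt e γ t
  have hstep : ∀ n γ, P n γ → ∃ γ', P (n + 1) γ' ∧ ∀ t, |t| ≤ (n + 1) * (ε / 2) → γ' t = γ t := by
    intro n γ hγ
    obtain ⟨γ', h1, h2⟩ := exists_extension hε hu (s := n * (ε / 2)) (by positivity) hγ
    refine ⟨γ', fun t ht => h2 t ?_, fun t ht => h1 t ?_⟩
    · push_cast at ht
      linarith
    · linarith
  choose! next hnext heq using hstep
  obtain ⟨γ₀, -, hγ₀⟩ := hu (Classical.arbitrary M) 0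
  let f : ℕ → ℝ → M := fun n => Nat.rec γ₀ (fun n γ => next n γ) n
  have hf : ∀ n, P n (f n) := fun n => by
    induction n with
    | zero => exact fun t ht => hγ₀ t (by simpa using ht)
    | succ n ih => exact hnext n _ ih
  have hfeq : ∀ (n k : ℕ) (t : ℝ), |t| ≤ n * (ε / 2) → f (n + k) t = f n t := fun n k t ht => by
    induction k with
    | zero => rfl
    | succ k ih =>
      rw [← ih]
      refine heq (n + k) _ (hf _) t (ht.trans ?_)
      push_cast
      nlinarith [(Nat.cast_nonneg k : (0 : ℝ) ≤ k)]
  -- The value at `t` is read off at the first stage from which it never changes.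
  let γ : ℝ → M := fun t => f ⌈|t| / (ε / 2)⌉₊ t
  have hγf : ∀ N : ℕ, ∀ t, |t| ≤ N * (ε / 2) → γ t = f N t := fun N t ht => by
    have h1 : ⌈|t| / (ε / 2)⌉₊ ≤ N := Nat.ceil_le.2 ((div_le_iff₀ (by positivity)).2 ht)
    obtain ⟨k, rfl⟩ := Nat.exists_eq_add_of_le h1
    exact (hfeq _ k t ((div_le_iff₀ (by positivity)).1 (Nat.le_ceil _))).symm
  refine ⟨γ, fun t => ?_⟩
  obtain ⟨N, hN⟩ := exists_nat_gt (|t| / (ε / 2))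
  rw [div_lt_iff₀ (by positivity)] at hN
  refine (hf N t (by linarith)).congr ?_
  filter_upwards [continuous_abs.continuousAt.eventually (gt_mem_nhds hN)] with x hx
  exact hγf N x (le_of_lt hx)

variable {γ : ℝ → M}

/-- The range is open because unit speed curves are open maps. It is closed because a chart curve
around a limit point `q` meets `γ`, and the identity principle carries an isometric
reparametrization of `γ` along it to `q`. -/
theorem surjective_of_isUnitSpeedAt [T2Space M] [PreconnectedSpace M]
    (hC : ∀ p, ∃ C : UnitChart e, p ∈ C.U) (hγ : ∀ t, IsUnitSpeedAt e γ t) :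
    Function.Surjective γ := by
  have hopen : IsOpen (range γ) := by
    rw [isOpen_iff_mem_nhds]
    rintro _ ⟨t, rfl⟩
    simpa using (hγ t).image_mem_nhds univ_mem
  have hclosed : IsClosed (range γ) := by
    rw [← closure_subset_iff_isClosed]
    intro q hq
    obtain ⟨C, hqC⟩ := hC q
    obtain ⟨ρ, hρ, hball⟩ := Metric.isOpen_iff.1 C.isOpen_D _ (C.r_mem q hqC)
    have hgood : ∀ t ∈ Metric.ball (C.r q) ρ, IsUnitSpeedAt e C.c t := fun t ht =>
      ⟨C, 0, by simpa using hball ht, Eventually.of_forall fun _ => by simp⟩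
    have himg := (hgood _ (Metric.mem_ball_self hρ)).image_mem_nhds (Metric.ball_mem_nhds _ hρ)
    rw [C.c_r q hqC] at himg
    obtain ⟨_, ⟨s', hs', rfl⟩, ⟨s, hs⟩⟩ := mem_closure_iff_nhds.1 hq _ himg
    obtain ⟨σ, hσ, hev⟩ := (hgood s' hs').exists_eventuallyEq (hγ s) hs.symm
    have hδ : ∀ t, IsUnitSpeedAt e (fun t => γ (σ * t + (s - σ * s'))) t := fun t =>
      IsUnitSpeedAt.comp_isometry hσ (hγ _)
    have heq := eqOn_of_isUnitSpeedAt (Metric.isPreconnected_ball) hgood (fun t _ => hδ t) hs' (by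
      have htr : Tendsto (fun t : ℝ => t - s') (𝓝 s') (𝓝 0) := by
        have : Continuous fun t : ℝ => t - s' := by fun_prop
        simpa using this.tendsto s'
      filter_upwards [htr.eventually hev] with t ht
      convert ht using 2 <;> ring)
    exact ⟨σ * C.r q + (s - σ * s'), (heq (Metric.mem_ball_self hρ)).symm.trans (C.c_r q hqC)⟩
  rw [← range_eq_univ]
  exact (isClopen_iff.1 ⟨hclosed, hopen⟩).resolve_left (range_nonempty γ).ne_empty

/-- The local isometry matching the germs at `a` and `b` is a global symmetry of `γ`, by the
identity principle. -/
theorem isUnitSpeedAt_fiber [T2Space M] (hγ : ∀ t, IsUnitSpeedAt e γ t) {a b : ℝ}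
    (hab : γ a = γ b) : ∃ σ : ℝ, (σ = 1 ∨ σ = -1) ∧ ∀ t, γ (a + t) = γ (b + σ * t) := by
  obtain ⟨σ, hσ, hev⟩ := (hγ a).exists_eventuallyEq (hγ b) hab
  refine ⟨σ, hσ, fun t => ?_⟩
  have h1 : ∀ t, IsUnitSpeedAt e (fun t => γ (1 * t + a)) t := fun t =>
    IsUnitSpeedAt.comp_isometry (.inl rfl) (hγ _)
  have h2 : ∀ t, IsUnitSpeedAt e (fun t => γ (σ * t + b)) t := fun t =>
    IsUnitSpeedAt.comp_isometry hσ (hγ _)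
  have := eqOn_of_isUnitSpeedAt isPreconnected_univ (fun t _ => h1 t) (fun t _ => h2 t)
    (mem_univ 0) (by
      filter_upwards [hev] with t ht
      convert ht using 2 <;> ring) (mem_univ t)
  convert this using 2 <;> ring

end UnitSpeed

/-! ### Sheets and periods -/

section UnitSpeed

variable {F : Type*} [NormedAddCommGroup F] [NormedSpace ℝ F] {e : M → F}

/-- On `K`, near `s`, the curve `γ` does not fold. -/
def HasSheetAt (e : M → F) (γ : ℝ → M) (K : Set ℝ) (s : ℝ) : Prop :=
  ∃ (C : UnitChart e) (b σ : ℝ), (σ = 1 ∨ σ = -1) ∧ σ * (s + b) ∈ C.D ∧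
    ∀ᶠ t in 𝓝[K] s, 0 ≤ σ * (t + b) ∧ γ t = C.c (σ * (t + b))

variable {γ : ℝ → M} {K : Set ℝ} {s : ℝ}

/-- A fold at `s` makes `γ` symmetric there, and is invisible when `K` lies on one side of `s`. -/
theorem IsUnitSpeedAt.hasSheetAt (h : IsUnitSpeedAt e γ s)
    (hK : (¬ ∀ᶠ t in 𝓝 (0 : ℝ), γ (s + t) = γ (s - t)) ∨ K ⊆ Ici s ∨ K ⊆ Iic s) :
    HasSheetAt e γ K s := by
  obtain ⟨C, b, hb, hev⟩ := h
  have hc : ContinuousAt (fun t : ℝ => t + b) s := Continuous.continuousAt (by fun_prop)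
  have hevK : ∀ᶠ t in 𝓝[K] s, γ t = C.c (t + b) := nhdsWithin_le_nhds hev
  have pos : (∀ᶠ t in 𝓝[K] s, 0 ≤ t + b) → HasSheetAt e γ K s := fun h =>
    ⟨C, b, 1, .inl rfl, by rwa [one_mul], by
      filter_upwards [h, hevK] with t h1 h2
      rw [one_mul]
      exact ⟨h1, h2⟩⟩
  have neg : (∀ᶠ t in 𝓝[K] s, t + b ≤ 0) → HasSheetAt e γ K s := fun h =>
    ⟨C, b, -1, .inr rfl, by rw [neg_one_mul]; exact C.neg_mem _ hb, by
      filter_upwards [h, hevK] with t h1 h2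
      rw [neg_one_mul, C.c_neg]
      exact ⟨by linarith, h2⟩⟩
  rcases lt_trichotomy (s + b) 0 with h0 | h0 | h0
  · exact neg (nhdsWithin_le_nhds ((hc.eventually (gt_mem_nhds h0)).mono fun t ht => ht.le))
  · rcases hK with hK | hK | hK
    · refine absurd ?_ hK
      have h1 : Tendsto (fun t : ℝ => s + t) (𝓝 0) (𝓝 s) := by
        have : Continuous fun t : ℝ => s + t := by fun_prop
        simpa using this.tendsto 0
      have h2 : Tendsto (fun t : ℝ => s - t) (𝓝 0) (𝓝 s) := by
        have : Continuous fun t : ℝ => s - t := by fun_prop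
        simpa using this.tendsto 0
      filter_upwards [h1.eventually hev, h2.eventually hev] with t ht1 ht2
      rw [ht1, ht2, ← C.c_neg]
      congr 1
      linarith
    · exact pos (eventually_mem_nhdsWithin.mono fun t ht => by linarith [mem_Ici.1 (hK ht)])
    · exact neg (eventually_mem_nhdsWithin.mono fun t ht => by linarith [mem_Iic.1 (hK ht)])
  · exact pos (nhdsWithin_le_nhds ((hc.eventually (lt_mem_nhds h0)).mono fun t ht => ht.le))

namespace HasSheetAt

theorem contMDiffWithinAt (h : HasSheetAt e γ K s) (hs : s ∈ K) :
    ContMDiffWithinAt 𝓘(ℝ) (𝓡∂ 1) ∞ γ K s := by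
  obtain ⟨C, b, σ, -, hD, hev⟩ := h
  have hs' := hev.self_of_nhdsWithin hs
  have haff : ContMDiff 𝓘(ℝ) 𝓘(ℝ) ∞ fun t : ℝ => σ * (t + b) := by
    apply ContDiff.contMDiff
    fun_prop
  set K' := K ∩ (fun t : ℝ => σ * (t + b)) ⁻¹' (C.D ∩ Ici 0) with hK'
  have hmem : K' ∈ 𝓝[K] s := by
    have h1 : ∀ᶠ t in 𝓝[K] s, σ * (t + b) ∈ C.D :=
      nhdsWithin_le_nhds (haff.continuous.continuousAt.eventually (C.isOpen_D.mem_nhds hD))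
    filter_upwards [self_mem_nhdsWithin, h1, hev] with t h1 h2 h3
    exact ⟨h1, h2, h3.1⟩
  have hc := C.contMDiffOn_c (σ * (s + b)) ⟨hD, hs'.1⟩
  have hcomp := ContMDiffWithinAt.comp s hc (haff s).contMDiffWithinAt
    (show MapsTo (fun t : ℝ => σ * (t + b)) K' _ from fun t ht => ht.2)
  refine (hcomp.mono_of_mem_nhdsWithin hmem).congr_of_eventuallyEq ?_ hs'.2
  filter_upwards [hev] with t ht using ht.2

/-- On a sheet a section of `γ` is, up to sign and translation, the chart coordinate `C.r`.
Continuity thus upgrades to smoothness, which gives the inverse diffeomorphisms. -/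
theorem contMDiffAt_section {τ : M → ℝ} {m : M} (h : HasSheetAt e γ K (τ m))
    (hτ : ContinuousAt τ m) (hsec : ∀ᶠ x in 𝓝 m, τ x ∈ K ∧ γ (τ x) = x) :
    ContMDiffAt (𝓡∂ 1) 𝓘(ℝ) ∞ τ m := by
  obtain ⟨C, b, σ, hσ, hD, hev⟩ := h
  have hσσ : σ * σ = 1 := by rcases hσ with rfl | rfl <;> norm_num
  have htend : Tendsto τ (𝓝 m) (𝓝[K] (τ m)) :=
    tendsto_nhdsWithin_iff.2 ⟨hτ, hsec.mono fun x hx => hx.1⟩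
  have hm := hsec.self_of_nhds
  have hmγ := (hev.self_of_nhdsWithin hm.1).2
  have hmU : m ∈ C.U := by
    rw [← hm.2, hmγ]
    exact C.c_mem _ hD
  have hDev : ∀ᶠ x in 𝓝 m, σ * (τ x + b) ∈ C.D :=
    ((hτ.add_const b).const_mul σ).eventually (C.isOpen_D.mem_nhds hD)
  have haff : ContMDiff 𝓘(ℝ) 𝓘(ℝ) ∞ fun t : ℝ => σ * t - b := by
    apply ContDiff.contMDiff
    fun_prop
  have hr : ContMDiffAt (𝓡∂ 1) 𝓘(ℝ) ∞ C.r m :=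
    (C.contMDiffOn_r m hmU).contMDiffAt (C.isOpen_U.mem_nhds hmU)
  refine (ContMDiffAt.comp m (haff (C.r m)) hr).congr_of_eventuallyEq ?_
  filter_upwards [hsec, htend.eventually hev, hDev] with x h1 h2 h3
  have h4 : C.r x = σ * (τ x + b) := by
    conv_lhs => rw [← h1.2, h2.2]
    rw [C.r_c _ h3, abs_of_nonneg h2.1]
  simp only [Function.comp_apply, h4]
  linear_combination -(τ x + b) * hσσ

end HasSheetAt

/-- The periods of a function on the line. -/
def periodSubgroup {X : Type*} (γ : ℝ → X) : AddSubgroup ℝ where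
  carrier := {L | ∀ t, γ (t + L) = γ t}
  zero_mem' t := by rw [add_zero]
  add_mem' {L L'} h h' t := by rw [← add_assoc, h', h]
  neg_mem' {L} h t := by rw [← h (t + -L), neg_add_cancel_right]

theorem exists_generator_periodSubgroup (hγ : IsUnitSpeedAt e γ 0) {L₀ : ℝ} (h0 : L₀ ≠ 0)
    (hL₀ : L₀ ∈ periodSubgroup γ) :
    ∃ L > 0, ∀ x, x ∈ periodSubgroup γ ↔ ∃ n : ℤ, x = n * L := by
  obtain ⟨ε, hε, hinj⟩ := hγ.exists_injOn_Ico
  obtain ⟨b, hb⟩ := AddSubgroup.cyclic_of_isolated_zero (H := periodSubgroup γ) hε (by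
    rw [Set.disjoint_left]
    intro x hx hx'
    have h1 := hx 0
    have h2 := hinj ⟨by linarith [hx'.1], by linarith [hx'.2]⟩ ⟨le_rfl, by linarith⟩ h1
    simp only [zero_add] at h2
    exact hx'.1.ne' h2)
  have hmem : ∀ x, x ∈ periodSubgroup γ ↔ ∃ n : ℤ, x = n * b := fun x => by
    rw [hb, AddSubgroup.mem_closure_singleton]
    simp only [zsmul_eq_mul, eq_comm]
  have hb0 : b ≠ 0 := by
    rintro rfl
    obtain ⟨n, hn⟩ := (hmem L₀).1 hL₀
    simp at hn
    exact h0 hn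
  refine ⟨|b|, abs_pos.2 hb0, fun x => (hmem x).trans ?_⟩
  rcases abs_choice b with h | h <;> rw [h]
  constructor <;> rintro ⟨n, rfl⟩ <;> exact ⟨-n, by push_cast; ring⟩

/-- The sequence `γ n` clusters at some `γ s`, so `γ n` is also a value taken near `s` for some
large `n`. Both inequalities are needed: for even `γ` the period obtained may be `b - a` or `a + b`.
-/
theorem exists_eq_of_isUnitSpeedAt [CompactSpace M] (hγ : ∀ t, IsUnitSpeedAt e γ t)
    (hsurj : Function.Surjective γ) : ∃ a b, γ a = γ b ∧ a ≠ b ∧ a + b ≠ 0 := by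
  obtain ⟨x, hx⟩ := exists_clusterPt_of_compactSpace (map (fun n : ℕ => γ n) atTop)
  obtain ⟨s, rfl⟩ := hsurj x
  have himg := (hγ s).image_mem_nhds (Metric.ball_mem_nhds s one_pos)
  have hfr : ∃ᶠ n : ℕ in atTop, γ n ∈ γ '' Metric.ball s 1 :=
    mapClusterPt_iff_frequently.1 hx _ himg
  obtain ⟨n, ⟨s', hs', hn⟩, hlt⟩ :=
    (hfr.and_eventually (tendsto_natCast_atTop_atTop.eventually_gt_atTop (|s| + 1))).exists
  rw [Metric.mem_ball, Real.dist_eq, abs_lt] at hs'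
  have h1 := le_abs_self s
  have h2 := neg_abs_le s
  exact ⟨n, s', hn.symm, by intro h; linarith, by intro h; linarith⟩

theorem not_eventually_even [T2Space M] (hγ : ∀ t, IsUnitSpeedAt e γ t)
    (h : ¬ ∀ t, γ (s + t) = γ (s - t)) : ¬ ∀ᶠ t in 𝓝 (0 : ℝ), γ (s + t) = γ (s - t) := by
  intro hev
  refine h fun t => ?_
  have h1 : ∀ t, IsUnitSpeedAt e (fun t => γ (1 * t + s)) t := fun t =>
    IsUnitSpeedAt.comp_isometry (.inl rfl) (hγ _)
  have h2 : ∀ t, IsUnitSpeedAt e (fun t => γ (-1 * t + s)) t := fun t =>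
    IsUnitSpeedAt.comp_isometry (.inr rfl) (hγ _)
  have := eqOn_of_isUnitSpeedAt isPreconnected_univ (fun t _ => h1 t) (fun t _ => h2 t)
    (mem_univ 0) (by
      filter_upwards [hev] with t ht
      convert ht using 2 <;> ring) (mem_univ t)
  convert this using 2 <;> ring

end UnitSpeed

/-! ### The two models as quotients of the line -/

theorem contMDiffAt_arg_circle :
    ContMDiffAt (𝓡 1) 𝓘(ℝ) ∞ (fun z : Circle => Complex.arg z) 1 := by
  have := finrank_real_complex_fact'
  have h1 : ContMDiffAt (𝓡 1) 𝓘(ℝ, ℂ) ∞ (fun z : Circle => (z : ℂ)) 1 :=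
    contMDiff_coe_sphere (E := ℂ) (n := 1) (1 : Circle)
  have h2 : ContDiffAt ℝ ∞ (fun z : ℂ => (Complex.log z).im) ((1 : Circle) : ℂ) :=
    Complex.imCLM.contDiff.contDiffAt.comp _
      ((Complex.contDiffAt_log (by simp [Complex.slitPlane])).restrict_scalars ℝ)
  have h3 := ContMDiffAt.comp (1 : Circle) h2.contMDiffAt h1
  simp only [Complex.log_im] at h3
  exact h3

/-- A smooth local logarithm on the circle. -/
theorem exists_contMDiffAt_angle (θ : ℝ) :
    ∃ a : Circle → ℝ, ContMDiffAt (𝓡 1) 𝓘(ℝ) ∞ a (Circle.exp θ) ∧ a (Circle.exp θ) = θ ∧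
      ∀ z, Circle.exp (a z) = z := by
  refine ⟨fun z => θ + Complex.arg ((z * (Circle.exp θ)⁻¹ : Circle) : ℂ), ?_, by simp, fun z => ?_⟩
  · have h1 : ContMDiffAt (𝓡 1) (𝓡 1) ∞ (fun z : Circle => z * (Circle.exp θ)⁻¹) (Circle.exp θ) :=
      contMDiffAt_id.mul contMDiffAt_const
    have h2 : ContMDiffAt (𝓡 1) 𝓘(ℝ) ∞
        (fun z : Circle => Complex.arg ((z * (Circle.exp θ)⁻¹ : Circle) : ℂ)) (Circle.exp θ) :=
      ContMDiffAt.comp_of_eq (g := fun z : Circle => Complex.arg z) contMDiffAt_arg_circle h1 (by simp)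
    exact contMDiffAt_const.add h2
  · rw [Circle.exp_add, Circle.exp_arg, mul_comm, inv_mul_cancel_right]

section UnitSpeed

variable {F : Type*} [NormedAddCommGroup F] [NormedSpace ℝ F] {e : M → F} {γ : ℝ → M}

theorem nonempty_diffeomorph_circle [T2Space M] (hγ : ∀ t, HasSheetAt e γ univ t)
    (hsurj : Function.Surjective γ) {L : ℝ} (hL : 0 < L)
    (hper : ∀ a b, γ a = γ b ↔ ∃ n : ℤ, b = a + n * L) :
    Nonempty (M ≃ₘ⟮𝓡∂ 1, 𝓡 1⟯ Circle) := by
  set κ := L / (2 * Real.pi) with hκ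
  have hκ0 : κ ≠ 0 := by positivity
  have hκL : κ * (2 * Real.pi) = L := by rw [hκ]; field_simp
  -- The jump of `arg` is harmless: by `hf` any local smooth angle gives the same map, since `γ` has
  -- period `L`.
  let f : Circle → M := fun z => γ (κ * Complex.arg z)
  have hf : ∀ θ, f (Circle.exp θ) = γ (κ * θ) := fun θ => by
    obtain ⟨n, hn⟩ := Circle.exp_eq_exp.1 (Circle.exp_arg (Circle.exp θ)).symm
    refine (hper _ _).2 ⟨n, ?_⟩
    conv_lhs => rw [hn]
    rw [← hκL]
    ring
  have hsmooth : ContMDiff (𝓡 1) (𝓡∂ 1) ∞ f := by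
    intro z
    obtain ⟨θ, rfl⟩ := Circle.exp_surjective z
    obtain ⟨a, ha, haθ, hexp⟩ := exists_contMDiffAt_angle θ
    have h1 : f = γ ∘ fun z => κ * a z := funext fun z => by
      conv_lhs => rw [← hexp z, hf]
      rfl
    rw [h1]
    have h2 : ContMDiffAt 𝓘(ℝ) (𝓡∂ 1) ∞ γ (κ * a (Circle.exp θ)) :=
      contMDiffWithinAt_univ.1 ((hγ _).contMDiffWithinAt (mem_univ _))
    exact ContMDiffAt.comp (Circle.exp θ) h2 (contMDiffAt_const.mul ha)
  have hbij : Function.Bijective f := by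
    constructor
    · intro z w hzw
      obtain ⟨θ, rfl⟩ := Circle.exp_surjective z
      obtain ⟨φ, rfl⟩ := Circle.exp_surjective w
      rw [hf, hf] at hzw
      obtain ⟨n, hn⟩ := (hper _ _).1 hzw
      refine (Circle.exp_eq_exp.2 ⟨n, ?_⟩).symm
      rw [← hκL] at hn
      apply mul_left_cancel₀ hκ0
      rw [hn]
      ring
    · intro m
      obtain ⟨t, rfl⟩ := hsurj m
      exact ⟨Circle.exp (t / κ), by rw [hf, mul_div_cancel₀ _ hκ0]⟩
  let E : Circle ≃ M := Equiv.ofBijective f hbij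
  have hEc : Continuous E.symm :=
    (Continuous.homeoOfEquivCompactToT2 (f := E) hsmooth.continuous).symm.continuous
  refine ⟨{ toEquiv := E.symm, contMDiff_toFun := ?_, contMDiff_invFun := hsmooth }⟩
  intro m
  obtain ⟨θ, hθ⟩ := Circle.exp_surjective (E.symm m)
  obtain ⟨a, ha, haθ, hexp⟩ := exists_contMDiffAt_angle θ
  have hτ : ContMDiffAt (𝓡∂ 1) 𝓘(ℝ) ∞ (fun x => κ * a (E.symm x)) m := by
    refine (hγ _).contMDiffAt_section (K := univ) ?_ (Eventually.of_forall fun x => ⟨mem_univ _, ?_⟩)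
    · rw [hθ] at ha
      exact (ContinuousAt.comp ha.continuousAt hEc.continuousAt).const_mul κ
    · rw [← hf, hexp]
      exact E.apply_symm_apply x
  have h2 : (E.symm : M → Circle) = Circle.exp ∘ fun x => κ⁻¹ * (κ * a (E.symm x)) :=
    funext fun x => by
    simp only [Function.comp_apply]
    rw [inv_mul_cancel_left₀ hκ0, hexp]
  change ContMDiffAt (𝓡∂ 1) (𝓡 1) ∞ E.symm m
  rw [h2]
  exact ContMDiffAt.comp m (contMDiff_circleExp _) (contMDiffAt_const.mul hτ)

theorem nonempty_diffeomorph_Icc [T2Space M] {ℓ : ℝ} (hℓ : 0 < ℓ)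
    (hγ : ∀ t ∈ Icc 0 ℓ, HasSheetAt e γ (Icc 0 ℓ) t)
    (hinj : InjOn γ (Icc 0 ℓ)) (hsurj : ∀ m, ∃ t ∈ Icc 0 ℓ, γ t = m) :
    Nonempty (M ≃ₘ⟮𝓡∂ 1, 𝓡∂ 1⟯ (Icc (0 : ℝ) 1)) := by
  let f : Icc (0 : ℝ) 1 → M := fun t => γ (ℓ * t)
  have hmaps : ∀ t ∈ Icc (0 : ℝ) 1, ℓ * t ∈ Icc 0 ℓ := fun t ht =>
    ⟨mul_nonneg hℓ.le ht.1, by nlinarith [ht.2]⟩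
  have hsmooth : ContMDiff (𝓡∂ 1) (𝓡∂ 1) ∞ f := by
    rw [← contMDiffOn_comp_projIcc_iff]
    have h1 : ContMDiffOn 𝓘(ℝ) (𝓡∂ 1) ∞ γ (Icc 0 ℓ) := fun t ht => (hγ t ht).contMDiffWithinAt ht
    have h2 : ContMDiff 𝓘(ℝ) 𝓘(ℝ) ∞ fun t : ℝ => ℓ * t := by
      apply ContDiff.contMDiff
      fun_prop
    refine (h1.comp h2.contMDiffOn hmaps).congr fun t ht => ?_
    simp only [Function.comp_apply, f]
    rw [projIcc_of_mem _ ht]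
  have hbij : Function.Bijective f := by
    constructor
    · intro s t hst
      have := hinj (hmaps s s.2) (hmaps t t.2) hst
      exact Subtype.ext (mul_left_cancel₀ hℓ.ne' this)
    · intro m
      obtain ⟨t, ht, rfl⟩ := hsurj m
      refine ⟨⟨t / ℓ, div_nonneg ht.1 hℓ.le, (div_le_one hℓ).2 ht.2⟩, ?_⟩
      simp only [f]
      rw [mul_div_cancel₀ _ hℓ.ne']
  let E : Icc (0 : ℝ) 1 ≃ M := Equiv.ofBijective f hbij
  have hEc : Continuous E.symm :=
    (Continuous.homeoOfEquivCompactToT2 (f := E) hsmooth.continuous).symm.continuous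
  refine ⟨{ toEquiv := E.symm, contMDiff_toFun := ?_, contMDiff_invFun := hsmooth }⟩
  refine contMDiff_iff_comp_subtypeVal_Icc.2 ⟨hEc, fun m => ?_⟩
  have hτ : ContMDiffAt (𝓡∂ 1) 𝓘(ℝ) ∞ (fun x => ℓ * (E.symm x : ℝ)) m := by
    refine (hγ _ (hmaps _ (E.symm m).2)).contMDiffAt_section ?_
      (Eventually.of_forall fun x => ⟨hmaps _ (E.symm x).2, E.apply_symm_apply x⟩)
    exact ((continuous_subtype_val.comp hEc).const_mul ℓ).continuousAt
  have h2 : (fun z : Icc (0 : ℝ) 1 => (z : ℝ)) ∘ E.symm = fun x => ℓ⁻¹ * (ℓ * (E.symm x : ℝ)) :=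
    funext fun x => by
      rw [inv_mul_cancel_left₀ hℓ.ne']
      rfl
  change ContMDiffAt (𝓡∂ 1) 𝓘(ℝ) ∞ ((fun z : Icc (0 : ℝ) 1 => (z : ℝ)) ∘ E.symm) m
  rw [h2]
  exact contMDiffAt_const.mul hτ

end UnitSpeed

/-! ### The classification -/

/-- **Classification of compact connected one-dimensional manifolds with boundary.** -/
theorem nonempty_diffeomorph_circle_or_Icc [IsManifold (𝓡∂ 1) ∞ M] [T2Space M] [CompactSpace M]
    [ConnectedSpace M] : Nonempty (M ≃ₘ⟮𝓡∂ 1, 𝓡 1⟯ Circle) ∨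
      Nonempty (M ≃ₘ⟮𝓡∂ 1, 𝓡∂ 1⟯ (Icc (0 : ℝ) 1)) := by
  -- Only smoothness and the immersion property are kept; `e` serves to measure speed.
  obtain ⟨n, e, he, -, hinj⟩ := exists_embedding_euclidean_of_compact (I := 𝓡∂ 1) (M := M)
  have hC : ∀ p, ∃ C : UnitChart e, p ∈ C.U := exists_unitChart he hinj
  obtain ⟨γ₀, hγ₀⟩ := exists_forall_isUnitSpeedAt hC
  by_cases hrefl : ∃ c, ∀ t, γ₀ (c + t) = γ₀ (c - t)
  · right
    obtain ⟨c, hc⟩ := hrefl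
    obtain ⟨γ, hγ, heven⟩ : ∃ γ : ℝ → M, (∀ t, IsUnitSpeedAt e γ t) ∧ ∀ t, γ (-t) = γ t := by
      refine ⟨fun t => γ₀ (1 * t + c), fun t => IsUnitSpeedAt.comp_isometry (.inl rfl) (hγ₀ _),
        fun t => ?_⟩
      have := hc t
      convert this.symm using 2 <;> ring
    have hsurj := surjective_of_isUnitSpeedAt hC hγ
    have hfib : ∀ a b, γ a = γ b → b - a ∈ periodSubgroup γ ∨ a + b ∈ periodSubgroup γ := by
      intro a b hab
      obtain ⟨σ, rfl | rfl, h⟩ := isUnitSpeedAt_fiber hγ hab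
      · left
        intro t
        have := h (t - a)
        rw [add_sub_cancel] at this
        rw [this]
        congr 1
        ring
      · right
        intro t
        have := h (-t - a)
        rw [add_sub_cancel, heven] at this
        rw [this]
        congr 1
        ring
    obtain ⟨a, b, hab, hne, hne'⟩ := exists_eq_of_isUnitSpeedAt hγ hsurj
    obtain ⟨L, hL, hmem⟩ : ∃ L > 0, ∀ x, x ∈ periodSubgroup γ ↔ ∃ n : ℤ, x = n * L := by
      rcases hfib a b hab with h | h
      · exact exists_generator_periodSubgroup (hγ 0) (sub_ne_zero.2 hne.symm) h
      · exact exists_generator_periodSubgroup (hγ 0) hne' h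
    have hsmall : ∀ x ∈ periodSubgroup γ, |x| < L → x = 0 := by
      intro x hx hlt
      obtain ⟨n, rfl⟩ := (hmem x).1 hx
      rw [abs_mul, abs_of_pos hL] at hlt
      have h1 : |(n : ℝ)| < 1 := by nlinarith
      have h2 : |n| < 1 := by exact_mod_cast h1
      rw [Int.abs_lt_one_iff.1 h2]
      simp
    have hLmem : L ∈ periodSubgroup γ := (hmem L).2 ⟨1, by simp⟩
    -- The symmetries are generated by `t ↦ -t` and `t ↦ t + L`, with fundamental domain `[0, L /
    -- 2]`.
    refine nonempty_diffeomorph_Icc (e := e) (γ := γ) (ℓ := L / 2) (by positivity) ?_ ?_ ?_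
    · intro s hs
      refine (hγ s).hasSheetAt ?_
      rcases hs.1.eq_or_lt with rfl | h0
      · exact .inr (.inl Icc_subset_Ici_self)
      rcases hs.2.eq_or_lt with h1 | h1
      · exact .inr (.inr (h1 ▸ Icc_subset_Iic_self))
      -- Reflections in `0` and `s` compose to translation by `2 * s`, which is too short to be a
      -- period.
      · refine .inl (not_eventually_even hγ fun h => ?_)
        have hper : 2 * s ∈ periodSubgroup γ := fun t => by
          have := h (t + s)
          rw [← heven (s - (t + s))] at this
          convert this using 2 <;> ring
        have := hsmall _ hper (by rw [abs_of_pos] <;> linarith)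
        linarith
    · intro s hs t ht hst
      rcases hfib s t hst with h | h
      · have := hsmall _ h (by rw [abs_lt]; constructor <;> linarith [hs.1, hs.2, ht.1, ht.2])
        linarith
      · rcases (add_nonneg hs.1 ht.1).eq_or_lt with h0 | h0
        · linarith [hs.1, ht.1]
        · by_cases hlt : s + t < L
          · have := hsmall _ h (by rwa [abs_of_pos h0])
            linarith
          · linarith [hs.2, ht.2]
    · intro m
      obtain ⟨t, rfl⟩ := hsurj m
      have hshift : ∀ n : ℤ, γ (t - n * L) = γ t := fun n => by
        have : -(n * L) ∈ periodSubgroup γ := neg_mem ((hmem _).2 ⟨n, rfl⟩)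
        exact this t
      set n := ⌊t / L⌋
      have h1 : 0 ≤ t - n * L := by
        have := (le_div_iff₀ hL).1 (Int.floor_le (t / L))
        linarith
      have h2 : t - n * L < L := by
        have := (div_lt_iff₀ hL).1 (Int.lt_floor_add_one (t / L))
        linarith
      by_cases h3 : t - n * L ≤ L / 2
      · exact ⟨_, ⟨h1, h3⟩, hshift n⟩
      · refine ⟨L - (t - n * L), ⟨by linarith, by linarith⟩, ?_⟩
        rw [← hshift n, ← heven (t - n * L), sub_eq_neg_add]
        exact hLmem _
  · left
    have hsurj := surjective_of_isUnitSpeedAt hC hγ₀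
    have hfib : ∀ a b, γ₀ a = γ₀ b → b - a ∈ periodSubgroup γ₀ := by
      intro a b hab
      obtain ⟨σ, rfl | rfl, h⟩ := isUnitSpeedAt_fiber hγ₀ hab
      · intro t
        have := h (t - a)
        rw [add_sub_cancel] at this
        rw [this]
        congr 1
        ring
      -- An orientation-reversing coincidence would be a reflection in the midpoint.
      · refine absurd ⟨(a + b) / 2, fun t => ?_⟩ hrefl
        have := h ((b - a) / 2 + t)
        convert this using 2 <;> ring
    obtain ⟨a, b, hab, hne, -⟩ := exists_eq_of_isUnitSpeedAt hγ₀ hsurj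
    obtain ⟨L, hL, hmem⟩ :=
      exists_generator_periodSubgroup (hγ₀ 0) (sub_ne_zero.2 hne.symm) (hfib a b hab)
    refine nonempty_diffeomorph_circle (e := e) (γ := γ₀) (fun s => ?_) hsurj hL
      fun a b => ⟨fun h => ?_, ?_⟩
    · exact (hγ₀ s).hasSheetAt (.inl (not_eventually_even hγ₀ fun h => hrefl ⟨s, h⟩))
    · obtain ⟨n, hn⟩ := (hmem _).1 (hfib a b h)
      exact ⟨n, by linarith⟩
    · rintro ⟨n, rfl⟩
      exact ((hmem _).2 ⟨n, rfl⟩ a).symm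

/-! ### Parity of the boundary -/

theorem boundary_even_of_connectedSpace [IsManifold (𝓡∂ 1) ∞ M] [T2Space M] [CompactSpace M]
    [ConnectedSpace M] :
    ((𝓡∂ 1).boundary M).Finite ∧ Even ((𝓡∂ 1).boundary M).ncard := by
  rcases nonempty_diffeomorph_circle_or_Icc (M := M) with ⟨⟨Φ⟩⟩ | ⟨⟨Φ⟩⟩
  · have : IsManifold (𝓡 1) ∞ Circle := IsManifold.of_le (n := ω) le_top
    rw [← Φ.preimage_boundary (by simp), ModelWithCorners.Boundaryless.boundary_eq_empty]
    simp
  · have himg : (𝓡∂ 1).boundary M = Φ.symm '' {⊥, ⊤} := by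
      rw [← boundary_Icc (x := (0 : ℝ)) (y := 1), Φ.symm.image_boundary (by simp)]
    have hinj : Function.Injective (Φ.symm : Icc (0 : ℝ) 1 → M) := Φ.symm.injective
    rw [himg, ncard_image_of_injective _ hinj, ncard_pair (by simp)]
    exact ⟨(toFinite _).image _, even_two⟩

/-- Components of a manifold are open, so by compactness there are finitely many, each a compact
manifold in its own right; the even counts add up. -/
theorem boundary_even [IsManifold (𝓡∂ 1) ∞ M] [T2Space M] [CompactSpace M] :
    ((𝓡∂ 1).boundary M).Finite ∧ Even ((𝓡∂ 1).boundary M).ncard := by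
  classical
  have : LocallyConnectedSpace M := ChartedSpace.locallyConnectedSpace (EuclideanHalfSpace 1) M
  have : DiscreteTopology (ConnectedComponents M) :=
    ConnectedComponents.discreteTopology_iff.2 fun x => isOpen_connectedComponent
  have : Finite (ConnectedComponents M) := finite_of_compact_of_discrete
  set B := (𝓡∂ 1).boundary M with hB
  have key : ∀ x : M, (B ∩ connectedComponent x).Finite ∧ Even (B ∩ connectedComponent x).ncard := by
    intro x
    let V : TopologicalSpace.Opens M := ⟨connectedComponent x, isOpen_connectedComponent⟩
    have : ConnectedSpace V := isConnected_iff_connectedSpace.1 isConnected_connectedComponent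
    have : CompactSpace V := isCompact_iff_compactSpace.1 isClosed_connectedComponent.isCompact
    have h := boundary_even_of_connectedSpace (M := V)
    rw [ModelWithCorners.boundary_open] at h
    have himg : B ∩ connectedComponent x = (Subtype.val : V → M) '' (Subtype.val ⁻¹' B) := by
      ext y
      exact ⟨fun h => ⟨⟨y, h.2⟩, h.1, rfl⟩, fun ⟨z, hz, hzy⟩ => hzy ▸ ⟨hz, z.2⟩⟩
    rw [himg, ncard_image_of_injective _ Subtype.val_injective]
    exact ⟨h.1.image _, h.2⟩
  have key' : ∀ c : ConnectedComponents M, (B ∩ {x | ConnectedComponents.mk x = c}).Finite ∧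
      Even (B ∩ {x | ConnectedComponents.mk x = c}).ncard := by
    intro c
    obtain ⟨x, rfl⟩ := ConnectedComponents.surjective_coe c
    have : {y : M | ConnectedComponents.mk y = ConnectedComponents.mk x} = connectedComponent x := by
      ext y
      simp only [mem_ofPred_eq]
      rw [ConnectedComponents.coe_eq_coe']
    rw [this]
    exact key x
  have hfin : B.Finite := by
    have hU : B = ⋃ c : ConnectedComponents M, B ∩ {x | ConnectedComponents.mk x = c} := by
      ext y
      simp
    rw [hU]
    exact finite_iUnion fun c => (key' c).1
  refine ⟨hfin, ?_⟩
  have := Fintype.ofFinite (ConnectedComponents M)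
  rw [ncard_eq_toFinset_card B hfin, Finset.card_eq_sum_card_fiberwise
    (f := fun x => ConnectedComponents.mk x) (t := Finset.univ)
    (fun _ _ => Finset.mem_coe.2 (Finset.mem_univ _))]
  refine Finset.even_sum _ fun c _ => ?_
  have hc : ((hfin.toFinset.filter fun x => ConnectedComponents.mk x = c : Finset M) : Set M) =
      B ∩ {x | ConnectedComponents.mk x = c} := by
    ext y
    simp
  rw [← ncard_coe_finset, hc]
  exact (key' c).2

/-- The witness is a disjoint union of `k` intervals. -/
theorem exists_boundary_ncard_eq (k : ℕ) :
    ∃ (M : Type u) (_ : TopologicalSpace M) (_ : T2Space M) (_ : CompactSpace M)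
      (_ : ChartedSpace (EuclideanHalfSpace 1) M) (_ : IsManifold (𝓡∂ 1) ∞ M),
      ((𝓡∂ 1).boundary M).Finite ∧ ((𝓡∂ 1).boundary M).ncard = k + k := by
  induction k with
  | zero =>
    let _ : ChartedSpace (EuclideanHalfSpace 1) PEmpty.{u + 1} := ChartedSpace.empty _ _
    refine ⟨PEmpty.{u + 1}, inferInstance, inferInstance, inferInstance, inferInstance,
      inferInstance, toFinite _, ?_⟩
    rw [Set.eq_empty_of_isEmpty ((𝓡∂ 1).boundary PEmpty.{u + 1}), ncard_empty]
  | succ k ih =>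
    obtain ⟨M, _, _, _, _, _, hfin, hcard⟩ := ih
    refine ⟨M ⊕ Icc (0 : ℝ) 1, inferInstance, inferInstance, inferInstance, inferInstance,
      inferInstance, ?_⟩
    rw [ModelWithCorners.boundary_disjointUnion, boundary_Icc]
    have h2 : ({⊥, ⊤} : Set (Icc (0 : ℝ) 1)).Finite := toFinite _
    refine ⟨(hfin.image _).union (h2.image _), ?_⟩
    rw [ncard_union_eq _ (hfin.image _) (h2.image _), ncard_image_of_injective _ Sum.inl_injective,
      ncard_image_of_injective _ Sum.inr_injective, hcard, ncard_pair (by simp)]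
    · ring
    · rw [Set.disjoint_left]
      rintro _ ⟨x, -, rfl⟩ ⟨y, -, h⟩
      cases h

/-! ### Cobordism of zero-dimensional manifolds -/

theorem isSmoothEmbedding_of_injective_of_mem_boundary [IsManifold (𝓡∂ 1) ∞ M] {X : Type*}
    [TopologicalSpace X] [ChartedSpace (EuclideanSpace ℝ (Fin 0)) X] [IsManifold (𝓡 0) ∞ X]
    [T2Space M] [CompactSpace X] {f : X → M} (hf : Function.Injective f)
    (hmem : ∀ x, f x ∈ (𝓡∂ 1).boundary M) :
    Manifold.IsSmoothEmbedding (𝓡 0) (𝓡∂ 1) ∞ f := by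
  have : DiscreteTopology X := ChartedSpace.discreteTopology (EuclideanSpace ℝ (Fin 0)) X
  have hc : Continuous f := continuous_of_discreteTopology
  refine ⟨Manifold.IsImmersionOfComplement.isImmersion (F := EuclideanSpace ℝ (Fin 1)) fun x => ?_,
    (hc.isClosedEmbedding hf).isEmbedding⟩
  -- The immersion normal form is linear, so it sends the only point of `ℝ⁰` to `0`. The preferred
  -- charts fit it because a boundary point has coordinate exactly `0`.
  refine Manifold.IsImmersionAtOfComplement.mk_of_continuousAt hc.continuousAt
    (ContinuousLinearEquiv.uniqueProd ℝ (EuclideanSpace ℝ (Fin 1)) (EuclideanSpace ℝ (Fin 0)))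
    (chartAt _ x) (chartAt _ (f x)) (mem_chart_source _ x) (mem_chart_source _ (f x))
    (IsManifold.chart_mem_maximalAtlas x) (IsManifold.chart_mem_maximalAtlas (f x)) ?_
  intro z _
  have hz : z = extChartAt (𝓡 0) x x := Subsingleton.elim _ _
  have hz0 : z = 0 := Subsingleton.elim _ _
  have hx : ((chartAt (EuclideanSpace ℝ (Fin 0)) x).extend (𝓡 0)).symm z = x := by
    rw [hz]
    exact extChartAt_to_inv x
  have h0 : extChartAt (𝓡∂ 1) (f x) (f x) = 0 := by
    have h := hmem x
    rw [ModelWithCorners.boundary, mem_ofPred_eq, ModelWithCorners.isBoundaryPoint_iff,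
      frontier_range_modelWithCornersEuclideanHalfSpace] at h
    ext i
    fin_cases i
    exact Eq.symm h
  simp only [Function.comp_apply, hx]
  exact h0.trans (by rw [hz0]; exact (map_zero _).symm)

namespace ClosedManifold

theorem finite_carrier (M : ClosedManifold.{u} 0) : Finite M.carrier := by
  have : DiscreteTopology M.carrier := ChartedSpace.discreteTopology (EuclideanSpace ℝ (Fin 0)) _
  exact finite_of_compact_of_discrete

theorem cobordant_iff_even (M N : ClosedManifold.{u} 0) :
    M.Cobordant N ↔ Even (Nat.card M.carrier + Nat.card N.carrier) := by
  have := M.finite_carrier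
  have := N.finite_carrier
  rw [← Nat.card_sum]
  constructor
  · rintro ⟨W, _, _, _, _, _, f, hf, hr⟩
    have h := (boundary_even (M := W)).2
    have h2 : (range f).ncard = Nat.card (M.carrier ⊕ N.carrier) := by
      rw [← image_univ, ncard_image_of_injective _ hf.isEmbedding.injective, ncard_univ]
    rw [← h2, hr]
    exact h
  · rintro ⟨k, hk⟩
    obtain ⟨W, _, _, _, _, _, hfin, hcard⟩ := exists_boundary_ncard_eq.{u} k
    have := hfin.to_subtype
    have hcard' : Nat.card (M.carrier ⊕ N.carrier) = Nat.card ((𝓡∂ 1).boundary W) := by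
      rw [hk, Nat.card_coe_set_eq, hcard]
    -- Any bijection onto the boundary will do, as smoothness is automatic in dimension zero.
    obtain ⟨E⟩ := Finite.card_eq.1 hcard'
    refine ⟨W, inferInstance, inferInstance, inferInstance, inferInstance, inferInstance,
      Subtype.val ∘ E, ?_, ?_⟩
    · exact isSmoothEmbedding_of_injective_of_mem_boundary
        (Subtype.val_injective.comp E.injective) fun x => (E x).2
    · rw [range_comp, E.surjective.range_eq, image_univ, Subtype.range_coe]

theorem card_empty : Nat.card (empty.{u} 0).carrier = 0 := Nat.card_eq_zero.2 
  (.inl (inferInstanceAs (IsEmpty PEmpty)))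

theorem card_point : Nat.card point.{u}.carrier = 1 := Nat.card_unique (α := PUnit)

end ClosedManifold

end

theorem theorem1 :
    -- a compact one-dimensional manifold with boundary has an even number of boundary points
    (∀ (M : Type u) [TopologicalSpace M] [T2Space M] [CompactSpace M]
        [ChartedSpace (EuclideanHalfSpace 1) M] [IsManifold (𝓡∂ 1) ∞ M],
      ((𝓡∂ 1).boundary M).Finite ∧ Even ((𝓡∂ 1).boundary M).ncard) ∧
    -- if it is connected, it is a circle or a compact interval
    (∀ (M : Type u) [TopologicalSpace M] [T2Space M] [CompactSpace M] [ConnectedSpace M]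
        [ChartedSpace (EuclideanHalfSpace 1) M] [IsManifold (𝓡∂ 1) ∞ M],
      Nonempty (M ≃ₘ⟮𝓡∂ 1, 𝓡 1⟯ Circle) ∨
        Nonempty (M ≃ₘ⟮𝓡∂ 1, 𝓡∂ 1⟯ (Set.Icc (0 : ℝ) 1))) ∧
    -- `m` points are the boundary of such a manifold if and only if `m` is even
    (∀ m : ℕ,
      (∃ (M : Type u) (_ : TopologicalSpace M) (_ : T2Space M) (_ : CompactSpace M)
          (_ : ChartedSpace (EuclideanHalfSpace 1) M) (_ : IsManifold (𝓡∂ 1) ∞ M),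
        ((𝓡∂ 1).boundary M).Finite ∧ ((𝓡∂ 1).boundary M).ncard = m) ↔ Even m) ∧
    -- a closed 0-manifold is finite, and it is cobordant to the empty manifold or to a point
    -- according to the parity of its number of points
    (∀ M : ClosedManifold.{u} 0, Finite M.carrier ∧
      (M.Cobordant (ClosedManifold.empty 0) ↔ Even (Nat.card M.carrier)) ∧
      (M.Cobordant ClosedManifold.point ↔ Odd (Nat.card M.carrier))) ∧
    -- cobordism of closed 0-manifolds is an equivalence relation with exactly two classes,
    -- distinguished by the parity of the number of points
    Equivalence (ClosedManifold.Cobordant (n := 0) :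
      ClosedManifold.{u} 0 → ClosedManifold.{u} 0 → Prop) ∧
    (∀ M N : ClosedManifold.{u} 0, M.Cobordant N ↔
      (Even (Nat.card M.carrier) ↔ Even (Nat.card N.carrier))) ∧
    Nat.card (ClosedManifold.CobordismClass.{u} 0) = 2 := by
  have hiff : ∀ M N : ClosedManifold.{u} 0, M.Cobordant N ↔
      (Even (Nat.card M.carrier) ↔ Even (Nat.card N.carrier)) := fun M N => by
    rw [M.cobordant_iff_even N, Nat.even_add]
  have hequiv : Equivalence (ClosedManifold.Cobordant (n := 0) :
      ClosedManifold.{u} 0 → ClosedManifold.{u} 0 → Prop) :=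
    ⟨fun M => (hiff M M).2 Iff.rfl, fun h => (hiff _ _).2 ((hiff _ _).1 h).symm,
      fun h h' => (hiff _ _).2 (((hiff _ _).1 h).trans ((hiff _ _).1 h'))⟩
  refine ⟨fun M => by intros; exact boundary_even,
    fun M => by intros; exact nonempty_diffeomorph_circle_or_Icc, fun m => ⟨?_, ?_⟩,
    fun M => ⟨M.finite_carrier, ?_, ?_⟩, hequiv, hiff, ?_⟩
  · rintro ⟨M, _, _, _, _, _, -, rfl⟩
    exact boundary_even.2
  · rintro ⟨k, rfl⟩
    exact exists_boundary_ncard_eq k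
  · rw [hiff, ClosedManifold.card_empty]
    simp
  · rw [hiff, ClosedManifold.card_point]
    simp
  · rw [Nat.card_eq_two_iff]
    refine ⟨Quot.mk _ (ClosedManifold.empty 0), Quot.mk _ ClosedManifold.point, fun h => ?_, ?_⟩
    -- Equality in `Quot` means the generated equivalence, which is cobordism itself by `hequiv`.
    · have := hequiv.eqvGen_iff.1 (Quot.eqvGen_exact h)
      rw [hiff, ClosedManifold.card_empty, ClosedManifold.card_point] at this
      simp at this
    · refine Set.eq_univ_of_forall fun c => ?_
      induction c using Quot.ind with | _ M => ?_
      by_cases hM : Even (Nat.card M.carrier)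
      · left
        exact Quot.sound ((hiff _ _).2 (by simp [ClosedManifold.card_empty, hM]))
      · right
        exact Quot.sound ((hiff _ _).2 (by simp [ClosedManifold.card_point, hM]))
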